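/- For $n\ge 1$ let $B_n$ (the heavy binary tree) be the graph obtained from the balanced binary tree with $n$ vertices $0,\dots,n-1$ in level order (root $0$; the children of $i$ are those of $2i+1$, $2i+2$ that are smaller than $n$) by adding an edge between every pair of its $\lceil n/2\rceil$ leaves. Let $D_n$ (the Siamese heavy binary tree) be the graph obtained from two copies of $B_n$ by merging the two roots into a single vertex. Consider the following synchronous protocols on a graph $G=(V,E)$ with source vertex $s\in V$. *Push.* In round $0$ exactly $s$ is informed. In each round $t\ge 1$ every vertex that was informed in a previous round samples an independent uniformly random neighbor, which becomes informed (if it is not already). $T_{\rm push}$ is the number of rounds before all vertices are informed. *Agents.* A finite set $A$ of agents perform independent simple random walks on $G$, one step per round, each starting from the stationary distribution (vertex $v$ with probability $\deg(v)/(2|E|)$). *Visit-exchange.* In round $0$ the vertex $s$ and all agents on $s$ become informed. In each round $t\ge1$, after all agents have moved, every vertex visited by an agent that was informed in a previous round becomes informed; then every agent located on an informed vertex becomes informed. $T_{\rm visitx}$ is the number of rounds before all vertices are informed. *Meet-exchange.* In the first round $t\ge 0$ in which some agent is on $s$, all agents that are on $s$ become informed. In every later round, every agent that is on the same vertex as an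 agent informed in a previous round becomes informed. $T_{\rm meetx}$ is the number of rounds before all agents are informed. Then, on $G=D_n$ and for any source vertex $s$ of $D_n$ (all constants and thresholds below being independent of $s$): (a) $T_{\rm push}=O(\log n)$ with high probability: for every $c>0$ there are $C$ and $N$ such that $\Pr[T_{\rm push}\le C\log n]\ge 1-n^{-c}$ for all $n\ge N$ and all $s$. Moreover, for all constants $a>0$ and $b$ there are $\kappa>0$ and $N$ such that, for all $n\ge N$, all $s$, and every number of agents $|A|$ with $an\le |A|\le bn$: (b) $\mathbb{E}[T_{\rm visitx}]\ge \kappa n$, that is, $\mathbb{E}[T_{\rm visitx}]=\Omega(n)$; (c) $\mathbb{E}[T_{\rm meetx}]\ge \kappa n$, that is, $\mathbb{E}[T_{\rm meetx}]=\Omega(n)$. -/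

import Mathlib

open MeasureTheory
open scoped ENNReal

noncomputable section

/-! ### The graphs -/

/-- In the balanced binary tree on the vertices `0, …, n - 1` in level (heap) order, the children of
`i` are those of `2 * i + 1` and `2 * i + 2` that are smaller than `n`, and `0` is the root. -/
def IsChild {n : ℕ} (i j : Fin n) : Prop :=
  (j : ℕ) = 2 * i + 1 ∨ (j : ℕ) = 2 * i + 2

instance {n : ℕ} (i j : Fin n) : Decidable (IsChild i j) :=
  inferInstanceAs (Decidable (_ ∨ _))

/-- A leaf of the balanced binary tree is a vertex without children. -/
def IsLeaf {n : ℕ} (i : Fin n) : Prop :=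
  ∀ j : Fin n, ¬ IsChild i j

instance {n : ℕ} (i : Fin n) : Decidable (IsLeaf i) :=
  inferInstanceAs (Decidable (∀ _, _))

/-- The heavy binary tree `B_n`: the balanced binary tree with `n` vertices, with an added edge
between every pair of leaves. -/
def heavyBinaryTree (n : ℕ) : SimpleGraph (Fin n) where
  Adj i j := i ≠ j ∧ (IsChild i j ∨ IsChild j i ∨ (IsLeaf i ∧ IsLeaf j))
  symm := ⟨fun _ _ h => ⟨h.1.symm, by tauto⟩⟩
  loopless := ⟨fun _ h => h.1 rfl⟩

instance (n : ℕ) : DecidableRel (heavyBinaryTree n).Adj :=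
  fun i j => inferInstanceAs (Decidable (i ≠ j ∧ _))

/-- Two copies of the vertex set `V`, with the two copies of `r` merged into a single vertex `none`;
`some (b, v)` is the vertex `v` in copy number `b`. -/
def Siamese (V : Type) (r : V) : Type :=
  Option (Bool × {v : V // v ≠ r})

namespace Siamese

variable {V : Type} {r : V}

instance [DecidableEq V] : DecidableEq (Siamese V r) :=
  inferInstanceAs (DecidableEq (Option (Bool × {v : V // v ≠ r})))

instance [Fintype V] [DecidableEq V] : Fintype (Siamese V r) :=
  inferInstanceAs (Fintype (Option (Bool × {v : V // v ≠ r})))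

instance : Nonempty (Siamese V r) :=
  inferInstanceAs (Nonempty (Option (Bool × {v : V // v ≠ r})))

instance : MeasurableSpace (Siamese V r) := ⊤

instance : DiscreteMeasurableSpace (Siamese V r) := ⟨fun _ => trivial⟩

/-- The vertex `v` of copy number `b`. -/
def inCopy [DecidableEq V] (r : V) (b : Bool) (v : V) : Siamese V r :=
  if h : v = r then none else some (b, ⟨v, h⟩)

/-- Two copies of the graph `G`, with the two copies of the vertex `r` merged into one. -/
def graph [DecidableEq V] (G : SimpleGraph V) (r : V) : SimpleGraph (Siamese V r) :=
  G.map (inCopy r false) ⊔ G.map (inCopy r true)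

instance [DecidableEq V] [Fintype V] (G : SimpleGraph V) [DecidableRel G.Adj] (r : V) :
    DecidableRel (graph G r).Adj :=
  inferInstanceAs (DecidableRel (G.map (inCopy r false) ⊔ G.map (inCopy r true)).Adj)

end Siamese

/-- The vertices of the Siamese heavy binary tree `D_n`. -/
abbrev SiameseVertex (n : ℕ) [NeZero n] : Type :=
  Siamese (Fin n) 0

/-- The Siamese heavy binary tree `D_n`: two copies of `B_n`, with the two roots merged. -/
abbrev siameseHeavyBinaryTree (n : ℕ) [NeZero n] : SimpleGraph (SiameseVertex n) :=
  Siamese.graph (heavyBinaryTree n) 0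

/-! ### Broadcast protocols on a finite graph -/

lemma sum_degree_div {V : Type} [Fintype V] (G : SimpleGraph V) [DecidableRel G.Adj]
    (h : G.edgeFinset.card ≠ 0) :
    ∑ v, (G.degree v : ℝ≥0∞) / (2 * G.edgeFinset.card) = 1 := by
  simp_rw [div_eq_mul_inv]
  rw [← Finset.sum_mul, ← Nat.cast_sum, G.sum_degrees_eq_twice_card_edges, Nat.cast_mul,
    Nat.cast_ofNat]
  refine ENNReal.mul_inv_cancel ?_ ?_
  · simpa using h
  · exact ENNReal.mul_ne_top (by simp) (ENNReal.natCast_ne_top _)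

section Protocols

variable {V : Type} [Fintype V] [DecidableEq V] [Nonempty V] [MeasurableSpace V]
  (G : SimpleGraph V) [DecidableRel G.Adj]

/-- The first round in which `P` holds; it is `⊤` if there is none. -/
def firstRound (P : ℕ → Prop) : ℕ∞ :=
  ⨅ (t : ℕ) (_ : P t), (t : ℕ∞)

/-- A uniformly random neighbor of `u`. (On an isolated vertex, which does not occur in a connected
graph with at least two vertices, it is `u` itself.) -/
def randomNeighbor (u : V) : PMF V :=
  if h : (G.neighborFinset u).Nonempty then PMF.uniformOfFinset (G.neighborFinset u) h
  else PMF.pure u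

/-- The stationary distribution of the simple random walk on `G`: the vertex `v` has probability
`deg v / (2 |E|)`. (The uniform distribution if `G` has no edges.) -/
def stationary : PMF V :=
  if h : G.edgeFinset.card ≠ 0 then
    PMF.ofFintype (fun v => (G.degree v : ℝ≥0∞) / (2 * G.edgeFinset.card)) (sum_degree_div G h)
  else PMF.uniformOfFintype V

/-! #### Push -/

/-- The random choices of push: `ω t u` is the neighbor that `u` samples in round `t + 1`; all of
these are independent and uniformly random. (Samples of uninformed vertices are ignored.) -/
def pushMeasure : Measure (ℕ → V → V) :=
  Measure.infinitePi fun _ : ℕ => Measure.pi fun u : V => (randomNeighbor G u).toMeasure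

/-- The set of vertices that are informed after round `t` of push with source `s`. -/
def pushInformed (s : V) (ω : ℕ → V → V) : ℕ → Set V
  | 0 => {s}
  | t + 1 => pushInformed s ω t ∪ {v | ∃ u ∈ pushInformed s ω t, ω t u = v}

/-- The number of rounds of push before all vertices are informed. -/
def pushTime (s : V) (ω : ℕ → V → V) : ℕ∞ :=
  firstRound fun t => pushInformed s ω t = Set.univ

/-! #### Independent random walks -/

/-- The randomness of the walks of `m` agents: the starting position of every agent, and for every
round `t + 1`, agent `g` and vertex `v`, the vertex to which `g` moves in this round if it is on `v`
before it. -/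
abbrev WalkSpace (V : Type) (m : ℕ) : Type :=
  (Fin m → V) × (ℕ → Fin m → V → V)

/-- All agents start independently from the stationary distribution, and all moves are independent
of these and of each other and go to a uniformly random neighbor. -/
def walkMeasure (m : ℕ) : Measure (WalkSpace V m) :=
  (Measure.pi fun _ : Fin m => (stationary G).toMeasure).prod
    (Measure.infinitePi fun _ : ℕ => Measure.pi fun _ : Fin m =>
      Measure.pi fun v : V => (randomNeighbor G v).toMeasure)

/-- The position of agent `g` after round `t`. -/
def position {m : ℕ} (ω : WalkSpace V m) : ℕ → Fin m → V
  | 0, g => ω.1 g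
  | t + 1, g => ω.2 t g (position ω t g)

/-! #### Visit-exchange -/

/-- The set of vertices and the set of agents that are informed after round `t` of visit-exchange
with source `s`. -/
def visitxInformed {m : ℕ} (s : V) (ω : WalkSpace V m) : ℕ → Set V × Set (Fin m)
  | 0 => ({s}, {g | position ω 0 g = s})
  | t + 1 =>
    let I := visitxInformed s ω t
    let W := I.1 ∪ {v | ∃ g ∈ I.2, position ω (t + 1) g = v}
    (W, I.2 ∪ {g | position ω (t + 1) g ∈ W})

/-- The number of rounds of visit-exchange before all vertices are informed. -/
def visitxTime {m : ℕ} (s : V) (ω : WalkSpace V m) : ℕ∞ :=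
  firstRound fun t => (visitxInformed s ω t).1 = Set.univ

/-! #### Meet-exchange -/

open Classical in
/-- The set of agents that are informed after round `t` of meet-exchange with source `s`: as long as
no agent has been informed, agents become informed by visiting `s`; afterwards, they become informed
by meeting an agent that was informed in a previous round. -/
def meetxInformed {m : ℕ} (s : V) (ω : WalkSpace V m) : ℕ → Set (Fin m)
  | 0 => {g | position ω 0 g = s}
  | t + 1 =>
    if meetxInformed s ω t = ∅ then {g | position ω (t + 1) g = s}
    else meetxInformed s ω t ∪
      {g | ∃ g' ∈ meetxInformed s ω t, position ω (t + 1) g = position ω (t + 1) g'}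

/-- The number of rounds of meet-exchange before all agents are informed. -/
def meetxTime {m : ℕ} (s : V) (ω : WalkSpace V m) : ℕ∞ :=
  firstRound fun t => meetxInformed s ω t = Set.univ

end Protocols

end

set_option linter.unusedSectionVars false

/-! ### Independent rounds -/

/-! The graph is slow for agents and fast for push for the same reason: almost all edges lie in the
two leaf cliques, while the merged root is a cut vertex of degree at most 4.

Lower bounds. Since $|E| \ge n^2/16$, the root has stationary mass at most $32/n^2$. The walks are
stationary (`map_position_walkMeasure`), so $m \le \beta n$ agents make at most $1/8$ visits to the
root in expectation during $T = \lfloor n/(256\beta) \rfloor$ rounds. With probability at least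
$1/4$ there is no visit at all and a fixed agent starts on the side that does not contain $s$. As
long as the root is not visited nothing crosses it, so neither that agent nor its starting vertex is
informed before round $T$ (`le_lintegral_of_forall_not_visit`).

Push. Fix a target $v$ and let $C$ be the leaf clique in the copy of $s$. The informed part of $C$
grows by a constant factor in expectation until it exceeds half of $C$; then some leaf samples its
parent with constant probability per round; from there the rumor follows a path of at most $D =
2\log_2 n$ edges to $v$, and every step of it leaves an internal vertex, of degree at most 4, hence
succeeds with probability at least $1/4$. A single function, `potential`, covers all the phases: it
contracts by $7/8$ in expectation per round (`integral_potential_pushStep_le`), starts at no more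
than $4n^3$ and is at least 1 while $v$ is uninformed. Markov's inequality and a union bound over
the at most $2n$ targets give failure probability at most $8n^4(7/8)^t$, which is small for $t$ a
large multiple of $\log n$. -/

theorem DependsOn.exists_comp_restrict {Ω S : Type} [Nonempty Ω] {Y : (ℕ → Ω) → S} {t : ℕ}
    (hY : DependsOn Y (Set.Iio t)) :
    ∃ g : ((Finset.range t) → Ω) → S, ∀ ω, Y ω = g (fun i => ω i) := by
  classical
  -- Coordinates outside the range get an arbitrary value, which `Y` ignores.
  refine ⟨fun x => Y fun i =>
    if h : i ∈ Finset.range t then x ⟨i, h⟩ else Classical.arbitrary Ω, fun ω => hY fun i hi => ?_⟩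
  have hi : i < t := hi
  simp [hi]

theorem DependsOn.measurable {Ω S : Type} [Nonempty Ω] [Finite Ω] [MeasurableSpace Ω]
    [DiscreteMeasurableSpace Ω] [MeasurableSpace S] {Y : (ℕ → Ω) → S} {t : ℕ}
    (hY : DependsOn Y (Set.Iio t)) : Measurable Y := by
  obtain ⟨g, hg⟩ := hY.exists_comp_restrict
  have : Y = g ∘ fun ω i => ω i := funext hg
  rw [this]
  exact (Measurable.of_discrete (f := g)).comp (by fun_prop)

/-- The randomness of round `t` is independent of everything that depends on earlier rounds. -/
theorem lintegral_infinitePi_round {Ω S : Type} [Nonempty Ω] [Finite Ω] [MeasurableSpace Ω]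
    [DiscreteMeasurableSpace Ω] (ν : Measure Ω) [IsProbabilityMeasure ν] {Y : (ℕ → Ω) → S} {t : ℕ}
    (hY : DependsOn Y (Set.Iio t)) (f : S → Ω → ℝ≥0∞) :
    ∫⁻ ω, f (Y ω) (ω t) ∂(Measure.infinitePi fun _ : ℕ => ν) =
      ∫⁻ ω, ∫⁻ ξ, f (Y ω) ξ ∂ν ∂(Measure.infinitePi fun _ : ℕ => ν) := by
  obtain ⟨g, hg⟩ := hY.exists_comp_restrict
  have hind := (ProbabilityTheory.iIndepFun_infinitePi (P := fun _ : ℕ => ν)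
    (X := fun _ x => x) (fun _ => measurable_id)).indepFun_finset (Finset.range t) {t}
    (by simp) (fun i => by fun_prop)
  have hind' : ProbabilityTheory.IndepFun (fun (ω : ℕ → Ω) (i : Finset.range t) => ω i)
      (fun ω => ω t) (Measure.infinitePi fun _ : ℕ => ν) :=
    hind.comp (φ := id) (ψ := fun x : (({t} : Finset ℕ) → Ω) => x ⟨t, by simp⟩) measurable_id
      (by fun_prop)
  have hlaw := hind'.map_prod_eq_prod_map_map
    (Measurable.aemeasurable (by fun_prop)) (Measurable.aemeasurable (by fun_prop))
  rw [Measure.infinitePi_map_eval (fun _ : ℕ => ν) t] at hlaw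
  -- Through `g` the integrand lives on a finite discrete space, so no measurability of `f` or
  -- structure on `S` is needed.
  simp only [hg]
  have h1 : ∫⁻ ω, f (g fun i => ω i) (ω t) ∂(Measure.infinitePi fun _ : ℕ => ν) =
      ∫⁻ p : (Finset.range t → Ω) × Ω, f (g p.1) p.2 ∂((Measure.infinitePi fun _ : ℕ => ν).map
        fun ω => (fun i : Finset.range t => ω i, ω t)) := by
    rw [lintegral_map Measurable.of_discrete (by fun_prop)]
  rw [h1, hlaw, lintegral_prod _ (Measurable.of_discrete.aemeasurable),
    lintegral_map Measurable.of_discrete (by fun_prop)]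


/-! ### Stationarity of the random walks -/

section Walks

variable {V : Type} [Fintype V] [DecidableEq V] [Nonempty V] [MeasurableSpace V]
  [DiscreteMeasurableSpace V] (G : SimpleGraph V) [DecidableRel G.Adj]

theorem randomNeighbor_apply_of_adj {u w : V} (h : G.Adj u w) :
    randomNeighbor G u w = (G.degree u : ℝ≥0∞)⁻¹ := by
  have hw : w ∈ G.neighborFinset u := by simpa using h
  have hn : (G.neighborFinset u).Nonempty := ⟨w, hw⟩
  rw [randomNeighbor, dif_pos hn, PMF.uniformOfFinset_apply_of_mem _ hw,
    G.card_neighborFinset_eq_degree]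

theorem randomNeighbor_apply_of_not_adj {u w : V} (hu : 0 < G.degree u) (h : ¬ G.Adj u w) :
    randomNeighbor G u w = 0 := by
  have hn : (G.neighborFinset u).Nonempty := by
    rwa [← Finset.card_pos, G.card_neighborFinset_eq_degree]
  rw [randomNeighbor, dif_pos hn]
  exact PMF.uniformOfFinset_apply_of_notMem _ (by simpa using h)

theorem stationary_apply (h : G.edgeFinset.card ≠ 0) (v : V) :
    stationary G v = (G.degree v : ℝ≥0∞) / (2 * G.edgeFinset.card) := by
  rw [stationary, dif_pos h]
  rfl

/-- Detailed balance, summed up. -/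
theorem sum_stationary_mul_randomNeighbor (hE : G.edgeFinset.card ≠ 0)
    (hG : ∀ v, 0 < G.degree v) (v : V) :
    ∑ u, stationary G u * randomNeighbor G u v = stationary G v := by
  have key : ∀ u, stationary G u * randomNeighbor G u v =
      if G.Adj v u then ((2 * G.edgeFinset.card : ℝ≥0∞))⁻¹ else 0 := by
    intro u
    split_ifs with h
    · rw [randomNeighbor_apply_of_adj G h.symm, stationary_apply G hE, div_eq_mul_inv, mul_right_comm,
        ENNReal.mul_inv_cancel (by exact_mod_cast (hG u).ne') (ENNReal.natCast_ne_top _), one_mul]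
    · rw [randomNeighbor_apply_of_not_adj G (hG u) (fun h' => h h'.symm), mul_zero]
  simp_rw [key]
  rw [← Finset.sum_filter, Finset.sum_const, stationary_apply G hE, nsmul_eq_mul, div_eq_mul_inv,
    ← G.card_neighborFinset_eq_degree, G.neighborFinset_eq_filter]

/-- The move of round `t + 1` is stored at index `t`, so the moves used up to round `t` have indices
strictly below `t`. -/
theorem position_dependsOn {m : ℕ} (x : Fin m → V) (t : ℕ) (g : Fin m) :
    DependsOn (fun ω : ℕ → Fin m → V → V => position (x, ω) t g) (Set.Iio t) := by
  induction t with
  | zero => intro ω ω' _; rfl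
  | succ t ih =>
    intro ω ω' h
    have h1 := ih (x := ω) (y := ω') fun i hi => h i (Nat.lt_succ_of_lt hi)
    have h2 := h t (Nat.lt_succ_self t)
    simp only [position] at h1 ⊢
    rw [h1, h2]

theorem measurable_position {m : ℕ} (t : ℕ) (g : Fin m) :
    Measurable fun ω : WalkSpace V m => position ω t g := by
  refine measurable_from_prod_countable_right (f := fun ω : WalkSpace V m => position ω t g)
    fun x => ?_
  exact (position_dependsOn x t g).measurable

instance isProbabilityMeasure_walkMeasure (m : ℕ) : IsProbabilityMeasure (walkMeasure G m) := by
  unfold walkMeasure; infer_instance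

/-- The walks are stationary. -/
theorem map_position_walkMeasure (hE : G.edgeFinset.card ≠ 0)
    (hG : ∀ v, 0 < G.degree v) {m : ℕ} (t : ℕ) (g : Fin m) :
    (walkMeasure G m).map (fun ω => position ω t g) = (stationary G).toMeasure := by
  induction t with
  | zero =>
    have h := measurePreserving_eval (fun _ : Fin m => (stationary G).toMeasure) g
    rw [← h.map_eq]
    have h2 : (fun ω : WalkSpace V m => position ω 0 g) = Function.eval g ∘ Prod.fst := rfl
    rw [h2, ← Measure.map_map (by fun_prop) (by fun_prop), walkMeasure,
      Measure.map_fst_prod]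
    simp
  | succ t ih =>
    refine Measure.ext_of_singleton fun v => ?_
    rw [Measure.map_apply (measurable_position _ _) (measurableSet_singleton v),
      ← lintegral_indicator_one (measurable_position _ _ (measurableSet_singleton v)),
      walkMeasure, lintegral_prod _ (by
        refine Measurable.aemeasurable ?_
        exact (measurable_one).indicator (measurable_position _ _ (measurableSet_singleton v)))]
    -- For a fixed start, averaging over the fresh randomness of index `t` turns the indicator of
    -- arriving at `v` into a transition probability.
    have step : ∀ x : Fin m → V, ∫⁻ y, ((fun ω : WalkSpace V m => position ω (t + 1) g) ⁻¹' {v}).indicator 1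
          (x, y) ∂(Measure.infinitePi fun _ : ℕ => Measure.pi fun _ : Fin m =>
            Measure.pi fun v : V => (randomNeighbor G v).toMeasure) =
        ∫⁻ y, randomNeighbor G (position (x, y) t g) v
          ∂(Measure.infinitePi fun _ : ℕ => Measure.pi fun _ : Fin m =>
            Measure.pi fun v : V => (randomNeighbor G v).toMeasure) := by
      intro x
      have := lintegral_infinitePi_round (Measure.pi fun _ : Fin m =>
            Measure.pi fun v : V => (randomNeighbor G v).toMeasure) (position_dependsOn x t g)
            (fun u ξ => if ξ g u = v then 1 else 0)
      refine (lintegral_congr fun y => ?_).trans (this.trans (lintegral_congr fun y => ?_))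
      · simp only [Set.indicator, Set.mem_preimage, Set.mem_singleton_iff, position, Pi.one_apply]
      · generalize position (x, y) t g = u
        have hmp : MeasurePreserving (fun ξ : Fin m → V → V => ξ g u)
            (Measure.pi fun _ : Fin m => Measure.pi fun v : V => (randomNeighbor G v).toMeasure)
            (randomNeighbor G u).toMeasure :=
          (measurePreserving_eval (fun v : V => (randomNeighbor G v).toMeasure) u).comp
            (measurePreserving_eval (fun _ : Fin m =>
              Measure.pi fun v : V => (randomNeighbor G v).toMeasure) g)
        have h3 := hmp.lintegral_comp (f := fun w => if w = v then (1 : ℝ≥0∞) else 0)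
          Measurable.of_discrete
        rw [h3]
        have h4 : (fun w => if w = v then (1 : ℝ≥0∞) else 0) = ({v} : Set V).indicator 1 := by
          ext w; simp [Set.indicator_apply]
        rw [h4, lintegral_indicator_one (measurableSet_singleton v),
          PMF.toMeasure_apply_singleton _ _ (measurableSet_singleton v)]
    simp_rw [step]
    have hm : Measurable fun ω : WalkSpace V m => randomNeighbor G (position ω t g) v :=
      (Measurable.of_discrete (f := fun u => randomNeighbor G u v)).comp (measurable_position t g)
    rw [← lintegral_prod (fun ω : WalkSpace V m => randomNeighbor G (position ω t g) v)
      hm.aemeasurable]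
    change ∫⁻ ω, randomNeighbor G (position ω t g) v ∂(walkMeasure G m) = _
    rw [← lintegral_map (f := fun u => randomNeighbor G u v) Measurable.of_discrete
      (measurable_position t g), ih, lintegral_fintype,
      PMF.toMeasure_apply_singleton _ _ (measurableSet_singleton v),
      ← sum_stationary_mul_randomNeighbor G hE hG v]
    refine Finset.sum_congr rfl fun u _ => ?_
    rw [PMF.toMeasure_apply_singleton _ _ (measurableSet_singleton u), mul_comm]

theorem walkMeasure_position_eq (hE : G.edgeFinset.card ≠ 0)
    (hG : ∀ v, 0 < G.degree v) {m : ℕ} (t : ℕ) (g : Fin m) (S : Set V) :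
    walkMeasure G m {ω | position ω t g ∈ S} = (stationary G).toMeasure S := by
  rw [← map_position_walkMeasure G hE hG t g,
    Measure.map_apply (measurable_position _ _) (MeasurableSet.of_discrete)]
  rfl

end Walks

theorem le_firstRound {P : ℕ → Prop} {T : ℕ} (h : ∀ t < T, ¬ P t) : (T : ℕ∞) ≤ firstRound P := by
  refine le_iInf₂ fun t ht => ?_
  by_contra hlt
  exact h t (by exact_mod_cast not_le.mp hlt) ht

theorem firstRound_le {P : ℕ → Prop} {t : ℕ} (h : P t) : firstRound P ≤ t :=
  iInf₂_le t h

/-! ### Lower bounds from a rarely visited cut vertex -/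

section Separation

variable {V : Type} [Fintype V] [DecidableEq V] [Nonempty V] [MeasurableSpace V]
  [DiscreteMeasurableSpace V] (G : SimpleGraph V) [DecidableRel G.Adj]

variable {G} in
/-- As long as no agent visits a cut vertex `r`, no agent enters or leaves a component `K` of its
complement. -/
theorem position_mem_component_iff {r : V} {K : Set V}
    (hK : ∀ u w, G.Adj u w → w ∈ K → u ∈ K ∨ u = r) {m T : ℕ} {ω : WalkSpace V m}
    (hadj : ∀ t g u, G.Adj u (ω.2 t g u)) (hvisit : ∀ t < T, ∀ g, position ω t g ≠ r)
    {t : ℕ} (ht : t + 1 < T) (g : Fin m) :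
    position ω (t + 1) g ∈ K ↔ position ω t g ∈ K := by
  have h := hadj t g (position ω t g)
  -- Entering `K` is excluded by the absence of visits to `r` in round `t`, leaving it by that in
  -- round `t + 1`.
  constructor
  · intro h1
    exact (hK _ _ h h1).resolve_right (hvisit t (by omega) g)
  · intro h1
    exact (hK _ _ h.symm h1).resolve_right (hvisit (t + 1) ht g)

variable {G} in
-- Both halves have to be carried through one induction: vertices are informed by agents that stay
-- outside `K`, and agents by standing on informed vertices, which lie outside `K`.
theorem visitxInformed_disjoint_component {r s : V} {K : Set V} (hs : s ∉ K)
    (hK : ∀ u w, G.Adj u w → w ∈ K → u ∈ K ∨ u = r) {m T : ℕ} {ω : WalkSpace V m}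
    (hadj : ∀ t g u, G.Adj u (ω.2 t g u)) (hvisit : ∀ t < T, ∀ g, position ω t g ≠ r)
    {t : ℕ} (ht : t < T) :
    (∀ v ∈ (visitxInformed s ω t).1, v ∉ K) ∧
      ∀ g ∈ (visitxInformed s ω t).2, position ω t g ∉ K := by
  induction t with
  | zero =>
    constructor
    · rintro v rfl; exact hs
    · intro g (hg : position ω 0 g = s); rwa [hg]
  | succ t ih =>
    obtain ⟨h1, h2⟩ := ih (by omega)
    have hmove := position_mem_component_iff hK hadj hvisit ht
    have hW : ∀ v ∈ (visitxInformed s ω (t + 1)).1, v ∉ K := by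
      rintro v (hv | ⟨g, hg, rfl⟩)
      · exact h1 v hv
      · rw [hmove]; exact h2 g hg
    refine ⟨hW, ?_⟩
    rintro g (hg | hg)
    · rw [hmove]; exact h2 g hg
    · exact hW _ hg

variable {G} in
-- An agent informed by a meeting shares the position of an agent outside `K`; one informed by the
-- source stands on `s`, which is also outside.
theorem meetxInformed_disjoint_component {r s : V} {K : Set V} (hs : s ∉ K)
    (hK : ∀ u w, G.Adj u w → w ∈ K → u ∈ K ∨ u = r) {m T : ℕ} {ω : WalkSpace V m}
    (hadj : ∀ t g u, G.Adj u (ω.2 t g u)) (hvisit : ∀ t < T, ∀ g, position ω t g ≠ r)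
    {t : ℕ} (ht : t < T) :
    ∀ g ∈ meetxInformed s ω t, position ω t g ∉ K := by
  induction t with
  | zero => intro g (hg : position ω 0 g = s); rwa [hg]
  | succ t ih =>
    have h2 := ih (by omega)
    have hmove := position_mem_component_iff hK hadj hvisit ht
    intro g hg
    rw [meetxInformed] at hg
    split_ifs at hg
    · have hg : position ω (t + 1) g = s := hg
      rwa [hg]
    · rcases hg with hg | ⟨g', hg', heq⟩
      · rw [hmove]; exact h2 g hg
      · rw [heq, hmove]; exact h2 g' hg'

/-- `WalkSpace` also contains moves along non-edges; they form a null set, which lets the separation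
argument be purely deterministic. -/
theorem ae_adj_move (hG : ∀ v, 0 < G.degree v) (m : ℕ) :
    ∀ᵐ ω ∂walkMeasure G m, ∀ t g u, G.Adj u (ω.2 t g u) := by
  rw [ae_all_iff]; intro t
  rw [ae_all_iff]; intro g
  rw [ae_all_iff]; intro u
  have hmp : MeasurePreserving (fun ω : WalkSpace V m => ω.2 t g u) (walkMeasure G m)
      (randomNeighbor G u).toMeasure :=
    (measurePreserving_eval (fun v : V => (randomNeighbor G v).toMeasure) u).comp
      ((measurePreserving_eval (fun _ : Fin m =>
        Measure.pi fun v : V => (randomNeighbor G v).toMeasure) g).comp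
      ((measurePreserving_eval_infinitePi (fun _ : ℕ => Measure.pi fun _ : Fin m =>
        Measure.pi fun v : V => (randomNeighbor G v).toMeasure) t).comp measurePreserving_snd))
  refine hmp.quasiMeasurePreserving.ae (p := fun w => G.Adj u w) ?_
  rw [ae_iff, PMF.toMeasure_apply_eq_zero_iff _ MeasurableSet.of_discrete, Set.disjoint_right]
  intro w hw hsupp
  exact (PMF.mem_support_iff _ _).mp hsupp (randomNeighbor_apply_of_not_adj G (hG u) hw)

/-- If agents rarely visit the cut vertex `r`, then with constant probability none of them does for
`T` rounds, while agent `g₀` stays in the component `K`. -/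
theorem le_lintegral_of_forall_not_visit (hE : G.edgeFinset.card ≠ 0) (hG : ∀ v, 0 < G.degree v)
    {r : V} {K : Set V} {m T : ℕ} (g₀ : Fin m)
    (hT : T * m * stationary G r ≤ 8⁻¹) (hπ : (stationary G).toMeasure Kᶜ ≤ 5 / 8)
    {f : WalkSpace V m → ℝ≥0∞}
    (hf : ∀ ω : WalkSpace V m, (∀ t g u, G.Adj u (ω.2 t g u)) →
      (∀ t < T, ∀ g, position ω t g ≠ r) → position ω 0 g₀ ∈ K → T ≤ f ω) :
    T * 4⁻¹ ≤ ∫⁻ ω, f ω ∂walkMeasure G m := by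
  set B : Set (WalkSpace V m) :=
    (⋃ t ∈ Finset.range T, ⋃ g ∈ Finset.univ, {ω | position ω t g ∈ ({r} : Set V)}) ∪
      {ω | position ω 0 g₀ ∈ Kᶜ} with hB
  have hBm : MeasurableSet B := by
    refine MeasurableSet.union (Finset.measurableSet_biUnion _ fun t _ =>
      Finset.measurableSet_biUnion _ fun g _ => ?_) ?_ <;>
    exact measurable_position _ _ MeasurableSet.of_discrete
  -- Union bound over rounds and agents: by stationarity each pair contributes the mass of `r`, for
  -- a total of at most `1/8`. No independence of the agents is used.
  have hBle : walkMeasure G m B ≤ 8⁻¹ + 5 / 8 := by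
    refine (measure_union_le _ _).trans (add_le_add ?_ ?_)
    · refine le_trans ((measure_biUnion_finset_le _ _).trans
        (Finset.sum_le_sum fun t _ => measure_biUnion_finset_le _ _)) ?_
      simp_rw [walkMeasure_position_eq G hE hG,
        PMF.toMeasure_apply_singleton _ _ (measurableSet_singleton r)]
      simpa [mul_assoc] using hT
    · rwa [walkMeasure_position_eq G hE hG]
  have hc : (4⁻¹ : ℝ≥0∞) ≤ walkMeasure G m Bᶜ := by
    rw [prob_compl_eq_one_sub hBm]
    have h34 : (8⁻¹ + 5 / 8 : ℝ≥0∞) = 3 / 4 := by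
      rw [← ENNReal.toReal_eq_toReal_iff' (by simp [ENNReal.div_eq_top]) (by simp [ENNReal.div_eq_top]),
        ENNReal.toReal_add (by simp) (by simp [ENNReal.div_eq_top])]
      norm_num
    have h14 : (4⁻¹ : ℝ≥0∞) + 3 / 4 = 1 := by
      rw [← ENNReal.toReal_eq_toReal_iff' (by simp [ENNReal.div_eq_top]) (by simp),
        ENNReal.toReal_add (by simp) (by simp [ENNReal.div_eq_top])]
      norm_num
    rw [h34] at hBle
    refine ENNReal.le_sub_of_add_le_right (measure_ne_top _ _) ?_
    calc _ ≤ (4⁻¹ : ℝ≥0∞) + 3 / 4 := by gcongr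
      _ = 1 := h14
  calc (T : ℝ≥0∞) * 4⁻¹ ≤ T * walkMeasure G m Bᶜ := by gcongr
    _ = ∫⁻ ω, Bᶜ.indicator (fun _ => (T : ℝ≥0∞)) ω ∂walkMeasure G m := by
      rw [lintegral_indicator hBm.compl, setLIntegral_const]
    _ ≤ _ := by
      refine lintegral_mono_ae ?_
      filter_upwards [ae_adj_move G hG m] with ω hω
      by_cases h : ω ∈ B
      · simp [h]
      · rw [Set.indicator_of_mem (by simpa using h)]
        simp only [hB, Set.mem_union, Set.mem_iUnion, Set.mem_ofPred_eq, not_or, not_exists,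
          Finset.mem_range, Finset.mem_univ, Set.mem_compl_iff, not_not,
          Set.mem_singleton_iff] at h
        exact hf ω hω (fun t ht g => h.1 t ht g trivial) h.2

theorem le_lintegral_visitxTime (hE : G.edgeFinset.card ≠ 0) (hG : ∀ v, 0 < G.degree v)
    {r s : V} {K : Set V} (hs : s ∉ K)
    (hK : ∀ u w, G.Adj u w → w ∈ K → u ∈ K ∨ u = r) {m T : ℕ} (hm : 0 < m)
    (hT : T * m * stationary G r ≤ 8⁻¹) (hπ : (stationary G).toMeasure Kᶜ ≤ 5 / 8) :
    T * 4⁻¹ ≤ ∫⁻ ω, (visitxTime s ω : ℝ≥0∞) ∂walkMeasure G m := by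
  refine le_lintegral_of_forall_not_visit G hE hG ⟨0, hm⟩ hT hπ fun ω hadj hvisit hg => ?_
  have : (T : ℕ∞) ≤ visitxTime s ω := by
    refine le_firstRound fun t ht huniv => ?_
    exact (visitxInformed_disjoint_component hs hK hadj hvisit ht).1 _
      (huniv.symm ▸ Set.mem_univ _) hg
  exact_mod_cast ENat.toENNReal_mono this

theorem le_lintegral_meetxTime (hE : G.edgeFinset.card ≠ 0) (hG : ∀ v, 0 < G.degree v)
    {r s : V} {K : Set V} (hs : s ∉ K)
    (hK : ∀ u w, G.Adj u w → w ∈ K → u ∈ K ∨ u = r) {m T : ℕ} (hm : 0 < m)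
    (hT : T * m * stationary G r ≤ 8⁻¹) (hπ : (stationary G).toMeasure Kᶜ ≤ 5 / 8) :
    T * 4⁻¹ ≤ ∫⁻ ω, (meetxTime s ω : ℝ≥0∞) ∂walkMeasure G m := by
  refine le_lintegral_of_forall_not_visit G hE hG ⟨0, hm⟩ hT hπ fun ω hadj hvisit hg => ?_
  have : (T : ℕ∞) ≤ meetxTime s ω := by
    refine le_firstRound fun t ht huniv => ?_
    -- Unlike a vertex, the uninformed agent moves, so it must be shown to stay in `K` up to the
    -- round in question.
    have hstay : ∀ t < T, position ω t ⟨0, hm⟩ ∈ K := by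
      intro t
      induction t with
      | zero => exact fun _ => hg
      | succ t ih =>
        exact fun h => (position_mem_component_iff hK hadj hvisit h _).mpr (ih (by omega))
    exact meetxInformed_disjoint_component hs hK hadj hvisit ht ⟨0, hm⟩
      (huniv.symm ▸ Set.mem_univ _) (hstay t ht)
  exact_mod_cast ENat.toENNReal_mono this

end Separation

/-! ### The Siamese heavy binary tree -/

section Graph

variable {n : ℕ} [NeZero n]

variable (n) in
/-- The merged root. -/
def siameseRoot : SiameseVertex n :=
  none

theorem Siamese.inCopy_zero (b : Bool) : Siamese.inCopy (0 : Fin n) b 0 = siameseRoot n :=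
  dif_pos rfl

theorem Siamese.inCopy_of_ne (b : Bool) {i : Fin n} (hi : i ≠ 0) :
    Siamese.inCopy (0 : Fin n) b i = (some (b, ⟨i, hi⟩) : Option _) :=
  dif_neg hi

theorem Siamese.inCopy_eq_inCopy_iff {b c : Bool} {i j : Fin n} :
    Siamese.inCopy 0 b i = Siamese.inCopy 0 c j ↔ i = j ∧ (b = c ∨ i = 0) := by
  constructor
  · intro h
    by_cases hi : i = 0 <;> by_cases hj : j = 0
    · exact ⟨hi.trans hj.symm, Or.inr hi⟩
    · rw [hi, Siamese.inCopy_zero] at h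
      exact (Option.some_ne_none _ ((h.trans (Siamese.inCopy_of_ne c hj)).symm)).elim
    · rw [hj, Siamese.inCopy_zero] at h
      exact (Option.some_ne_none _ ((Siamese.inCopy_of_ne b hi).symm.trans h)).elim
    · have := Option.some.inj
        ((Siamese.inCopy_of_ne b hi).symm.trans (h.trans (Siamese.inCopy_of_ne c hj)))
      simp only [Prod.mk.injEq, Subtype.mk.injEq] at this
      exact ⟨this.2, Or.inl this.1⟩
  · rintro ⟨rfl, rfl | rfl⟩
    · rfl
    · rw [Siamese.inCopy_zero, Siamese.inCopy_zero]

theorem Siamese.inCopy_injective (b : Bool) :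
    Function.Injective (Siamese.inCopy (0 : Fin n) b) :=
  fun _ _ h => (Siamese.inCopy_eq_inCopy_iff.mp h).1

theorem Siamese.exists_inCopy (x : SiameseVertex n) :
    ∃ b i, Siamese.inCopy (0 : Fin n) b i = x := by
  rcases x with _ | ⟨b, i, hi⟩
  · exact ⟨true, 0, dif_pos rfl⟩
  · exact ⟨b, i, dif_neg hi⟩

theorem siamese_adj_iff {x y : SiameseVertex n} :
    (siameseHeavyBinaryTree n).Adj x y ↔ ∃ b i j, (heavyBinaryTree n).Adj i j ∧
      Siamese.inCopy 0 b i = x ∧ Siamese.inCopy 0 b j = y := by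
  simp only [siameseHeavyBinaryTree, Siamese.graph, SimpleGraph.sup_adj, SimpleGraph.map_adj']
  constructor
  · rintro (⟨-, i, j, h⟩ | ⟨-, i, j, h⟩)
    · exact ⟨false, i, j, h⟩
    · exact ⟨true, i, j, h⟩
  · rintro ⟨b, i, j, h, rfl, rfl⟩
    have hne : Siamese.inCopy 0 b i ≠ Siamese.inCopy 0 b j := fun h' =>
      h.ne (Siamese.inCopy_injective b h')
    cases b
    · exact Or.inl ⟨hne, i, j, h, rfl, rfl⟩
    · exact Or.inr ⟨hne, i, j, h, rfl, rfl⟩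

theorem siamese_adj_inCopy {b : Bool} {i j : Fin n} (h : (heavyBinaryTree n).Adj i j) :
    (siameseHeavyBinaryTree n).Adj (Siamese.inCopy 0 b i) (Siamese.inCopy 0 b j) :=
  siamese_adj_iff.mpr ⟨b, i, j, h, rfl, rfl⟩

/-- Only the merged root has neighbors in both copies. -/
theorem exists_of_siamese_adj_inCopy {b : Bool} {i : Fin n} (hi : i ≠ 0) {y : SiameseVertex n}
    (h : (siameseHeavyBinaryTree n).Adj (Siamese.inCopy 0 b i) y) :
    ∃ j, (heavyBinaryTree n).Adj i j ∧ Siamese.inCopy 0 b j = y := by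
  obtain ⟨c, i', j, hij, hx, hy⟩ := siamese_adj_iff.mp h
  obtain ⟨rfl, rfl | h0⟩ := Siamese.inCopy_eq_inCopy_iff.mp hx
  · exact ⟨j, hij, hy⟩
  · exact (hi h0).elim

/-! ### Leaves, degrees and the number of edges -/

theorem isLeaf_iff (i : Fin n) : IsLeaf i ↔ n ≤ 2 * (i : ℕ) + 1 := by
  constructor
  · intro h
    by_contra hlt
    exact h ⟨2 * i + 1, by omega⟩ (Or.inl rfl)
  · rintro h j (hj | hj) <;> omega

/-- The parent of a vertex; the root is its own parent. -/
def treeParent (i : Fin n) : Fin n :=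
  ⟨((i : ℕ) - 1) / 2, by omega⟩

theorem isChild_treeParent {i : Fin n} (hi : i ≠ 0) : IsChild (treeParent i) i := by
  have : (i : ℕ) ≠ 0 := fun h => hi (Fin.ext (by simpa using h))
  simp only [IsChild, treeParent]
  omega

theorem not_isLeaf_treeParent {i : Fin n} (hi : i ≠ 0) : ¬ IsLeaf (treeParent i) :=
  fun h => h i (isChild_treeParent hi)

theorem adj_treeParent {i : Fin n} (hi : i ≠ 0) : (heavyBinaryTree n).Adj i (treeParent i) := by
  have h := isChild_treeParent hi
  refine ⟨?_, Or.inr (Or.inl h)⟩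
  intro heq
  have h' : IsChild i i := by rwa [← heq] at h
  rcases h' with h' | h' <;> omega

theorem IsLeaf.ne_zero (hn : 2 ≤ n) {i : Fin n} (h : IsLeaf i) : i ≠ 0 := by
  rintro rfl
  rw [isLeaf_iff, Fin.val_zero] at h
  omega

theorem card_neighborFinset_of_not_isLeaf {i : Fin n} (hi : ¬ IsLeaf i) :
    ((heavyBinaryTree n).neighborFinset i).card ≤ 3 := by
  have hsub : ((heavyBinaryTree n).neighborFinset i).image Fin.val ⊆
      {2 * (i : ℕ) + 1, 2 * (i : ℕ) + 2, ((i : ℕ) - 1) / 2} := by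
    intro k hk
    obtain ⟨j, hj, rfl⟩ := Finset.mem_image.mp hk
    rw [SimpleGraph.mem_neighborFinset] at hj
    obtain ⟨-, h | h | h⟩ := hj
    · rcases h with h | h <;> simp [h]
    · have : (j : ℕ) = ((i : ℕ) - 1) / 2 := by rcases h with h | h <;> omega
      simp [this]
    · exact (hi h.1).elim
  rw [← Finset.card_image_of_injective _ Fin.val_injective]
  exact (Finset.card_le_card hsub).trans Finset.card_le_three

theorem card_neighborFinset_zero (hn : 2 ≤ n) :
    ((heavyBinaryTree n).neighborFinset 0).card ≤ 2 := by
  have hsub : ((heavyBinaryTree n).neighborFinset 0).image Fin.val ⊆ {1, 2} := by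
    intro k hk
    obtain ⟨j, hj, rfl⟩ := Finset.mem_image.mp hk
    rw [SimpleGraph.mem_neighborFinset] at hj
    obtain ⟨-, h | h | h⟩ := hj
    · rcases h with h | h <;> simp [h]
    · rcases h with h | h <;> simp at h
    · exact (h.1.ne_zero hn rfl).elim
  rw [← Finset.card_image_of_injective _ Fin.val_injective]
  exact (Finset.card_le_card hsub).trans Finset.card_le_two

variable (n) in
/-- The leaves of the balanced binary tree. -/
def leaves : Finset (Fin n) :=
  Finset.univ.filter IsLeaf

theorem le_two_mul_card_leaves : n ≤ 2 * (leaves n).card := by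
  have h : (Finset.univ : Finset (Fin n)) ⊆
      leaves n ∪ (Finset.univ.filter fun i => ¬ IsLeaf i) := by
    intro i _
    by_cases hi : IsLeaf i <;> simp [leaves, hi]
  have h2 : (Finset.univ.filter fun i : Fin n => ¬ IsLeaf i).card ≤ n / 2 := by
    rw [← Finset.card_image_of_injective _ Fin.val_injective]
    calc _ ≤ (Finset.range (n / 2)).card := by
          refine Finset.card_le_card fun k hk => ?_
          obtain ⟨j, hj, rfl⟩ := Finset.mem_image.mp hk
          simp only [Finset.mem_filter, Finset.mem_univ, true_and, isLeaf_iff] at hj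
          rw [Finset.mem_range]
          omega
      _ = n / 2 := Finset.card_range _
  have h3 := (Finset.card_le_card h).trans (Finset.card_union_le _ _)
  rw [Finset.card_univ, Fintype.card_fin] at h3
  omega

theorem card_leaves_le : (leaves n).card ≤ n := by
  simpa using Finset.card_le_univ (leaves n)

/-- The parent takes the place of the leaf itself in the count, so the degree does not exceed the
size of the clique, as the clique phase of push requires. -/
theorem card_neighborFinset_of_isLeaf {i : Fin n} (hi : IsLeaf i) :
    ((heavyBinaryTree n).neighborFinset i).card ≤ (leaves n).card := by
  have hi' : i ∈ leaves n := by simpa [leaves] using hi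
  have hsub : (heavyBinaryTree n).neighborFinset i ⊆
      insert (treeParent i) ((leaves n).erase i) := by
    intro j hj
    rw [SimpleGraph.mem_neighborFinset] at hj
    obtain ⟨hne, h | h | h⟩ := hj
    · exact (hi j h).elim
    · refine Finset.mem_insert.mpr (Or.inl (Fin.ext ?_))
      simp only [treeParent]
      rcases h with h | h <;> omega
    · refine Finset.mem_insert_of_mem (Finset.mem_erase.mpr ⟨hne.symm, ?_⟩)
      simpa [leaves] using h.2
  refine (Finset.card_le_card hsub).trans ((Finset.card_insert_le _ _).trans ?_)
  rw [Finset.card_erase_of_mem hi']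
  have := Finset.card_pos.mpr ⟨i, hi'⟩
  omega

theorem siamese_neighborFinset_inCopy {b : Bool} {i : Fin n} (hi : i ≠ 0) :
    (siameseHeavyBinaryTree n).neighborFinset (Siamese.inCopy 0 b i) =
      ((heavyBinaryTree n).neighborFinset i).image (Siamese.inCopy 0 b) := by
  ext y
  rw [SimpleGraph.mem_neighborFinset, Finset.mem_image]
  constructor
  · intro h
    obtain ⟨j, hj, hy⟩ := exists_of_siamese_adj_inCopy hi h
    exact ⟨j, by simpa using hj, hy⟩
  · rintro ⟨j, hj, rfl⟩
    exact siamese_adj_inCopy (by simpa using hj)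

theorem siamese_degree_inCopy {b : Bool} {i : Fin n} (hi : i ≠ 0) :
    (siameseHeavyBinaryTree n).degree (Siamese.inCopy 0 b i) =
      ((heavyBinaryTree n).neighborFinset i).card := by
  rw [← SimpleGraph.card_neighborFinset_eq_degree, siamese_neighborFinset_inCopy hi,
    Finset.card_image_of_injective _ (Siamese.inCopy_injective b)]

theorem siamese_degree_root_le (hn : 2 ≤ n) :
    (siameseHeavyBinaryTree n).degree (siameseRoot n) ≤ 4 := by
  have hsub : (siameseHeavyBinaryTree n).neighborFinset (siameseRoot n) ⊆
      ((heavyBinaryTree n).neighborFinset 0).image (Siamese.inCopy 0 false) ∪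
        ((heavyBinaryTree n).neighborFinset 0).image (Siamese.inCopy 0 true) := by
    intro y hy
    rw [SimpleGraph.mem_neighborFinset] at hy
    obtain ⟨b, i, j, hij, hx, rfl⟩ := siamese_adj_iff.mp hy
    rw [← Siamese.inCopy_zero b] at hx
    obtain rfl := Siamese.inCopy_injective b hx
    have hj : j ∈ (heavyBinaryTree n).neighborFinset 0 := by simpa using hij
    rw [Finset.mem_union]
    cases b
    · exact Or.inl (Finset.mem_image_of_mem _ hj)
    · exact Or.inr (Finset.mem_image_of_mem _ hj)
  rw [← SimpleGraph.card_neighborFinset_eq_degree]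
  refine (Finset.card_le_card hsub).trans ((Finset.card_union_le _ _).trans ?_)
  have h1 := (Finset.card_image_le (s := (heavyBinaryTree n).neighborFinset 0)
    (f := Siamese.inCopy 0 false)).trans (card_neighborFinset_zero hn)
  have h2 := (Finset.card_image_le (s := (heavyBinaryTree n).neighborFinset 0)
    (f := Siamese.inCopy 0 true)).trans (card_neighborFinset_zero hn)
  omega

theorem siamese_degree_le_of_not_isLeaf (hn : 2 ≤ n) {b : Bool} {i : Fin n} (hi : ¬ IsLeaf i) :
    (siameseHeavyBinaryTree n).degree (Siamese.inCopy 0 b i) ≤ 4 := by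
  by_cases h0 : i = 0
  · subst h0
    rw [Siamese.inCopy_zero]
    exact siamese_degree_root_le hn
  · rw [siamese_degree_inCopy h0]
    exact (card_neighborFinset_of_not_isLeaf hi).trans (by norm_num)

theorem siamese_degree_pos (hn : 2 ≤ n) (x : SiameseVertex n) :
    0 < (siameseHeavyBinaryTree n).degree x := by
  obtain ⟨b, i, rfl⟩ := Siamese.exists_inCopy x
  rw [SimpleGraph.degree_pos_iff_exists_adj]
  by_cases h0 : i = 0
  · subst h0
    have h1 : (⟨1, hn⟩ : Fin n) ≠ 0 := fun h => by simpa using congrArg Fin.val h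
    have hp : treeParent (⟨1, hn⟩ : Fin n) = 0 := Fin.ext (by simp [treeParent])
    have := (adj_treeParent h1).symm
    rw [hp] at this
    exact ⟨_, siamese_adj_inCopy this⟩
  · exact ⟨_, siamese_adj_inCopy (adj_treeParent h0)⟩

theorem card_leaves_sub_one_le {i : Fin n} (hi : IsLeaf i) :
    (leaves n).card - 1 ≤ ((heavyBinaryTree n).neighborFinset i).card := by
  have hi' : i ∈ leaves n := by simpa [leaves] using hi
  rw [← Finset.card_erase_of_mem hi']
  refine Finset.card_le_card fun j hj => ?_
  rw [Finset.mem_erase] at hj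
  rw [SimpleGraph.mem_neighborFinset]
  exact ⟨hj.1.symm, Or.inr (Or.inr ⟨hi, by simpa [leaves] using hj.2⟩)⟩

/-- The leaves of one copy. -/
def leafClique (n : ℕ) [NeZero n] (b : Bool) : Finset (SiameseVertex n) :=
  (leaves n).image (Siamese.inCopy 0 b)

theorem card_leafClique (b : Bool) : (leafClique n b).card = (leaves n).card :=
  Finset.card_image_of_injective _ (Siamese.inCopy_injective b)

theorem mul_card_leaves_le (hn : 2 ≤ n) :
    (leaves n).card * ((leaves n).card - 1) ≤
      2 * (siameseHeavyBinaryTree n).edgeFinset.card := by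
  rw [← SimpleGraph.sum_degrees_eq_twice_card_edges]
  calc (leaves n).card * ((leaves n).card - 1)
      = ∑ x ∈ leafClique n false, ((leaves n).card - 1) := by
        rw [Finset.sum_const, card_leafClique, smul_eq_mul]
    _ ≤ ∑ x ∈ leafClique n false, (siameseHeavyBinaryTree n).degree x := by
        refine Finset.sum_le_sum fun x hx => ?_
        obtain ⟨i, hi, rfl⟩ := Finset.mem_image.mp hx
        have hl : IsLeaf i := by simpa [leaves] using hi
        rw [siamese_degree_inCopy (hl.ne_zero hn)]
        exact card_leaves_sub_one_le hl
    _ ≤ _ := Finset.sum_le_sum_of_subset (Finset.subset_univ _)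

/-- One leaf clique suffices: with at least `n / 2` leaves its degree sum is at least `n (n - 2) /
4`, which is at least `n ^ 2 / 8` once `n ≥ 4`. -/
theorem sq_le_card_edgeFinset (hn : 4 ≤ n) :
    n ^ 2 ≤ 16 * (siameseHeavyBinaryTree n).edgeFinset.card := by
  have h1 := mul_card_leaves_le (n := n) (by omega)
  have h2 := le_two_mul_card_leaves (n := n)
  obtain ⟨l, hl⟩ : ∃ l, (leaves n).card = l + 1 := ⟨(leaves n).card - 1, by omega⟩
  rw [hl] at h1 h2
  rw [Nat.add_sub_cancel] at h1
  nlinarith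

/-! ### Stationary mass of the root and of the two sides -/

theorem stationary_root_le (hn : 4 ≤ n) :
    stationary (siameseHeavyBinaryTree n) (siameseRoot n) ≤ 32 / (n : ℝ≥0∞) ^ 2 := by
  have hsq := sq_le_card_edgeFinset hn
  have hpos : 0 < n ^ 2 := by positivity
  have hE : (siameseHeavyBinaryTree n).edgeFinset.card ≠ 0 := by
    intro h; rw [h] at hsq; omega
  rw [stationary_apply _ hE, ENNReal.div_le_iff (by simpa using hE)
    (ENNReal.mul_ne_top (by simp) (ENNReal.natCast_ne_top _)), ← ENNReal.mul_div_right_comm,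
    ENNReal.le_div_iff_mul_le (Or.inl (by positivity)) (Or.inl (by simp))]
  have := siamese_degree_root_le (n := n) (by omega)
  have h : (siameseHeavyBinaryTree n).degree (siameseRoot n) * n ^ 2 ≤
      32 * (2 * (siameseHeavyBinaryTree n).edgeFinset.card) := by nlinarith
  exact_mod_cast h

/-- The non-root vertices of one copy. -/
def siameseSide (n : ℕ) [NeZero n] (b : Bool) : Finset (SiameseVertex n) :=
  (Finset.univ.erase 0).image (Siamese.inCopy 0 b)

theorem inCopy_mem_siameseSide {b c : Bool} {i : Fin n} :
    Siamese.inCopy 0 c i ∈ siameseSide n b ↔ i ≠ 0 ∧ c = b := by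
  simp only [siameseSide, Finset.mem_image, Finset.mem_erase, Finset.mem_univ, and_true,
    Siamese.inCopy_eq_inCopy_iff]
  constructor
  · rintro ⟨j, hj, rfl, rfl | h⟩
    · exact ⟨hj, rfl⟩
    · exact (hj h).elim
  · rintro ⟨hi, rfl⟩
    exact ⟨i, hi, rfl, Or.inl rfl⟩

theorem mem_siameseSide_of_adj {b : Bool} {x y : SiameseVertex n}
    (h : (siameseHeavyBinaryTree n).Adj x y) (hy : y ∈ siameseSide n b) :
    x ∈ siameseSide n b ∨ x = siameseRoot n := by
  obtain ⟨c, i, j, -, rfl, rfl⟩ := siamese_adj_iff.mp h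
  obtain ⟨-, rfl⟩ := inCopy_mem_siameseSide.mp hy
  by_cases hi : i = 0
  · right; rw [hi, Siamese.inCopy_zero]
  · left; exact inCopy_mem_siameseSide.mpr ⟨hi, rfl⟩

theorem exists_notMem_siameseSide (s : SiameseVertex n) : ∃ b, s ∉ siameseSide n b := by
  obtain ⟨b, i, rfl⟩ := Siamese.exists_inCopy s
  refine ⟨!b, fun h => ?_⟩
  have := (inCopy_mem_siameseSide.mp h).2
  cases b <;> simp at this

theorem sum_degree_siameseSide (b : Bool) :
    ∑ x ∈ siameseSide n b, (siameseHeavyBinaryTree n).degree x =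
      ∑ i ∈ Finset.univ.erase 0, ((heavyBinaryTree n).neighborFinset i).card := by
  rw [siameseSide, Finset.sum_image fun _ _ _ _ h => Siamese.inCopy_injective b h]
  exact Finset.sum_congr rfl fun i hi => siamese_degree_inCopy (Finset.mem_erase.mp hi).1

/-- By symmetry the sides have equal degree sums, and the root adds at most 4, so the complement of
a side has mass at most `1/2 + 1/|E|`. For `n ≥ 12` there are at least 9 edges, and 8 are enough for
`5/8`. -/
theorem stationary_compl_siameseSide_le (hn : 12 ≤ n) (b : Bool) :
    (stationary (siameseHeavyBinaryTree n)).toMeasure (siameseSide n b : Set _)ᶜ ≤ 5 / 8 := by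
  set G := siameseHeavyBinaryTree n with hG
  have hsq := sq_le_card_edgeFinset (n := n) (by omega)
  have hE : G.edgeFinset.card ≠ 0 := by
    intro h; rw [h] at hsq; nlinarith
  have hμ : (stationary G).toMeasure (siameseSide n b : Set _)ᶜ =
      ∑ x ∈ (siameseSide n b)ᶜ, stationary G x := by
    rw [← Finset.coe_compl, PMF.toMeasure_apply_finset]
  have hnot : siameseRoot n ∉ siameseSide n !b := by
    rw [← Siamese.inCopy_zero b, inCopy_mem_siameseSide]
    simp
  have huniv : (siameseSide n b)ᶜ ⊆ insert (siameseRoot n) (siameseSide n !b) := by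
    intro x hx
    obtain ⟨c, i, rfl⟩ := Siamese.exists_inCopy x
    rw [Finset.mem_compl, inCopy_mem_siameseSide] at hx
    rw [Finset.mem_insert, inCopy_mem_siameseSide]
    by_cases hi : i = 0
    · left; rw [hi, Siamese.inCopy_zero]
    · right
      refine ⟨hi, ?_⟩
      cases b <;> cases c <;> simp_all
  have hroot : G.degree (siameseRoot n) ≤ 4 := siamese_degree_root_le (by omega)
  have hsum := G.sum_degrees_eq_twice_card_edges
  rw [← Finset.sum_compl_add_sum (siameseSide n b)] at hsum
  have hle : ∑ x ∈ (siameseSide n b)ᶜ, G.degree x ≤ 4 + ∑ x ∈ siameseSide n !b, G.degree x := by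
    refine (Finset.sum_le_sum_of_subset huniv).trans ?_
    rw [Finset.sum_insert hnot]
    omega
  rw [sum_degree_siameseSide, ← sum_degree_siameseSide b] at hle
  rw [hμ]
  have hdiv : ∑ x ∈ (siameseSide n b)ᶜ, stationary G x =
      (∑ x ∈ (siameseSide n b)ᶜ, (G.degree x : ℝ≥0∞)) / (2 * G.edgeFinset.card) := by
    simp_rw [stationary_apply G hE]
    rw [div_eq_mul_inv, Finset.sum_mul]
    simp_rw [div_eq_mul_inv]
  rw [hdiv, ENNReal.div_le_iff (by simpa using hE)
    (ENNReal.mul_ne_top (by simp) (ENNReal.natCast_ne_top _)), ← ENNReal.mul_div_right_comm,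
    ENNReal.le_div_iff_mul_le (Or.inl (by simp)) (Or.inl (by simp))]
  have : (∑ x ∈ (siameseSide n b)ᶜ, G.degree x) * 8 ≤ 5 * (2 * G.edgeFinset.card) := by
    nlinarith
  exact_mod_cast this

/-- The common lower bound: information that has to pass through the root takes linear time. -/
theorem exists_linear_lower_bound (τ : ∀ (n m : ℕ) [NeZero n], SiameseVertex n →
      WalkSpace (SiameseVertex n) m → ℕ∞)
    (hτ : ∀ (n : ℕ) [NeZero n] (m T : ℕ) (s : SiameseVertex n) (b : Bool),
      (siameseHeavyBinaryTree n).edgeFinset.card ≠ 0 →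
      (∀ x, 0 < (siameseHeavyBinaryTree n).degree x) → s ∉ siameseSide n b → 0 < m →
      T * m * stationary (siameseHeavyBinaryTree n) (siameseRoot n) ≤ 8⁻¹ →
      (stationary (siameseHeavyBinaryTree n)).toMeasure (siameseSide n b : Set _)ᶜ ≤ 5 / 8 →
      T * 4⁻¹ ≤ ∫⁻ ω, (τ n m s ω : ℝ≥0∞) ∂walkMeasure (siameseHeavyBinaryTree n) m)
    (a b : ℝ) (ha : 0 < a) :
    ∃ (κ : ℝ) (N : ℕ), 0 < κ ∧ ∀ (n : ℕ) [NeZero n], N ≤ n →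
      ∀ m : ℕ, a * n ≤ m → (m : ℝ) ≤ b * n → ∀ s : SiameseVertex n,
        ENNReal.ofReal (κ * n) ≤
          ∫⁻ ω, (τ n m s ω : ℝ≥0∞) ∂walkMeasure (siameseHeavyBinaryTree n) m := by
  set β : ℝ := max b 1 with hβ
  have hβ1 : 1 ≤ β := le_max_right _ _
  -- The expected number of visits is at most `T * (β n) * (32 / n ^ 2)`, which is `1/8` at `T = n /
  -- (256 β)`. Rounding `T` down costs at most a factor 2, as `n ≥ 256 β`, and the success
  -- probability a factor 4: `256 * 2 * 4 = 2048`.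
  refine ⟨1 / (2048 * β), max 12 ⌈256 * β⌉₊, by positivity, fun n _ hn m ham hmb s => ?_⟩
  have hn12 : 12 ≤ n := (le_max_left _ _).trans hn
  have hnβ : 256 * β ≤ n := (Nat.le_ceil _).trans (by exact_mod_cast (le_max_right _ _).trans hn)
  have hn0 : (0 : ℝ) < n := by positivity
  have hm0 : 0 < m := by
    have : (0 : ℝ) < m := lt_of_lt_of_le (by positivity) ham
    exact_mod_cast this
  have hmβ : (m : ℝ) ≤ β * n := hmb.trans (by gcongr; exact le_max_left _ _)
  obtain ⟨c, hc⟩ := exists_notMem_siameseSide s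
  have hsq := sq_le_card_edgeFinset (n := n) (by omega)
  have hE : (siameseHeavyBinaryTree n).edgeFinset.card ≠ 0 := by
    intro h; rw [h] at hsq; nlinarith
  set T : ℕ := ⌊n / (256 * β)⌋₊ with hT
  have hx1 : 1 ≤ n / (256 * β) := by rw [le_div_iff₀ (by positivity)]; linarith
  have hT1 : (T : ℝ) ≤ n / (256 * β) := Nat.floor_le (by positivity)
  have hT2 : n / (256 * β) ≤ 2 * T := by
    have h1 := Nat.lt_floor_add_one (n / (256 * β))
    have h2 : (1 : ℝ) ≤ T := by exact_mod_cast (Nat.one_le_floor_iff _).mpr hx1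
    rw [← hT] at h1
    linarith
  have hvisit : T * m * stationary (siameseHeavyBinaryTree n) (siameseRoot n) ≤ 8⁻¹ := by
    have hreal : (T : ℝ) * m * (32 / (n : ℝ) ^ 2) ≤ 8⁻¹ := by
      calc (T : ℝ) * m * (32 / (n : ℝ) ^ 2)
          ≤ (n / (256 * β)) * (β * n) * (32 / (n : ℝ) ^ 2) := by gcongr
        _ = 8⁻¹ := by field_simp; norm_num
    calc (T : ℝ≥0∞) * m * stationary (siameseHeavyBinaryTree n) (siameseRoot n)
        ≤ T * m * (32 / (n : ℝ≥0∞) ^ 2) := by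
          gcongr; exact stationary_root_le (by omega)
      _ = ENNReal.ofReal ((T : ℝ) * m * (32 / (n : ℝ) ^ 2)) := by
          rw [ENNReal.ofReal_mul (by positivity), ENNReal.ofReal_mul (by positivity),
            ENNReal.ofReal_div_of_pos (by positivity), ENNReal.ofReal_pow (by positivity)]
          simp
      _ ≤ ENNReal.ofReal 8⁻¹ := ENNReal.ofReal_le_ofReal hreal
      _ = 8⁻¹ := by rw [ENNReal.ofReal_inv_of_pos (by norm_num)]; simp
  refine le_trans ?_ (hτ n m T s c hE (siamese_degree_pos (by omega)) hc hm0 hvisit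
    (stationary_compl_siameseSide_le hn12 c))
  have : 1 / (2048 * β) * n ≤ T * 4⁻¹ := by
    have h : 1 / (2048 * β) * (n : ℝ) = n / (256 * β) * 8⁻¹ := by field_simp; norm_num
    rw [h]; linarith
  refine (ENNReal.ofReal_le_ofReal this).trans (le_of_eq ?_)
  rw [ENNReal.ofReal_mul (by positivity), ENNReal.ofReal_inv_of_pos (by norm_num)]
  simp

theorem exists_visitxTime_lower_bound (a b : ℝ) (ha : 0 < a) :
    ∃ (κ : ℝ) (N : ℕ), 0 < κ ∧ ∀ (n : ℕ) [NeZero n], N ≤ n →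
      ∀ m : ℕ, a * n ≤ m → (m : ℝ) ≤ b * n → ∀ s : SiameseVertex n,
        ENNReal.ofReal (κ * n) ≤
          ∫⁻ ω, (visitxTime s ω : ℝ≥0∞) ∂walkMeasure (siameseHeavyBinaryTree n) m :=
  exists_linear_lower_bound (fun _ _ _ s ω => visitxTime s ω)
    (fun _ _ _ _ _ _ hE hd hs hm hT hπ => le_lintegral_visitxTime _ hE hd (r := siameseRoot _) hs
      (fun _ _ h hw => mem_siameseSide_of_adj h hw) hm hT hπ) a b ha

theorem exists_meetxTime_lower_bound (a b : ℝ) (ha : 0 < a) :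
    ∃ (κ : ℝ) (N : ℕ), 0 < κ ∧ ∀ (n : ℕ) [NeZero n], N ≤ n →
      ∀ m : ℕ, a * n ≤ m → (m : ℝ) ≤ b * n → ∀ s : SiameseVertex n,
        ENNReal.ofReal (κ * n) ≤
          ∫⁻ ω, (meetxTime s ω : ℝ≥0∞) ∂walkMeasure (siameseHeavyBinaryTree n) m :=
  exists_linear_lower_bound (fun _ _ _ s ω => meetxTime s ω)
    (fun _ _ _ _ _ _ hE hd hs hm hT hπ => le_lintegral_meetxTime _ hE hd (r := siameseRoot _) hs
      (fun _ _ h hw => mem_siameseSide_of_adj h hw) hm hT hπ) a b ha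

end Graph

/-! ### Push -/

section Push

variable {V : Type} [Fintype V] [DecidableEq V] [Nonempty V] [MeasurableSpace V]
  [DiscreteMeasurableSpace V] (G : SimpleGraph V) [DecidableRel G.Adj]

/-- The law of the samples of one round of push. -/
noncomputable abbrev roundMeasure : Measure (V → V) :=
  Measure.pi fun u : V => (randomNeighbor G u).toMeasure

/-- The informed vertices after a round of push with samples `ξ`. -/
def pushStep (I : Set V) (ξ : V → V) : Set V :=
  I ∪ {v | ∃ u ∈ I, ξ u = v}

theorem pushInformed_dependsOn (s : V) (t : ℕ) :
    DependsOn (fun ω : ℕ → V → V => pushInformed s ω t) (Set.Iio t) := by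
  induction t with
  | zero => intro ω ω' _; rfl
  | succ t ih =>
    intro ω ω' h
    have h1 := ih (x := ω) (y := ω') fun i hi => h i (Nat.lt_succ_of_lt hi)
    have h2 := h t (Nat.lt_succ_self t)
    simp only [pushInformed] at h1 ⊢
    rw [h1, h2]

theorem mem_pushInformed_self (s : V) (ω : ℕ → V → V) (t : ℕ) : s ∈ pushInformed s ω t := by
  induction t with
  | zero => exact Set.mem_singleton s
  | succ t ih => exact Or.inl ih

/-- A potential that contracts in expectation decays exponentially. -/
theorem lintegral_potential_pushInformed_le {Φ : Set V → ℝ≥0∞} {ρ : ℝ≥0∞} {s : V}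
    (hstep : ∀ I, s ∈ I → ∫⁻ ξ, Φ (pushStep I ξ) ∂roundMeasure G ≤ ρ * Φ I) (t : ℕ) :
    ∫⁻ ω, Φ (pushInformed s ω t) ∂pushMeasure G ≤ ρ ^ t * Φ {s} := by
  induction t with
  | zero => simp [pushInformed, pushMeasure]
  | succ t ih =>
    calc ∫⁻ ω, Φ (pushInformed s ω (t + 1)) ∂pushMeasure G
        = ∫⁻ ω, ∫⁻ ξ, Φ (pushStep (pushInformed s ω t) ξ) ∂roundMeasure G ∂pushMeasure G :=
          lintegral_infinitePi_round (roundMeasure G) (pushInformed_dependsOn s t)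
            (fun I ξ => Φ (pushStep I ξ))
      _ ≤ ∫⁻ ω, ρ * Φ (pushInformed s ω t) ∂pushMeasure G :=
          lintegral_mono fun ω => hstep _ (mem_pushInformed_self s ω t)
      _ = ρ * ∫⁻ ω, Φ (pushInformed s ω t) ∂pushMeasure G := by
          refine lintegral_const_mul _ ?_
          exact DependsOn.measurable (t := t) fun ω ω' h =>
            congrArg Φ (pushInformed_dependsOn s t h)
      _ ≤ ρ * (ρ ^ t * Φ {s}) := by gcongr
      _ = ρ ^ (t + 1) * Φ {s} := by rw [pow_succ']; ring

/-- Markov's inequality: the potential dominates the indicator that `v` is uninformed. Only sets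
containing `s` matter, since `s` stays informed. -/
theorem pushMeasure_notMem_le {Φ : Set V → ℝ} {ρ : ℝ} {s v : V} (hρ : 0 ≤ ρ) (hΦ : ∀ I, 0 ≤ Φ I)
    (hone : ∀ I, s ∈ I → v ∉ I → 1 ≤ Φ I)
    (hstep : ∀ I, s ∈ I → ∫ ξ, Φ (pushStep I ξ) ∂roundMeasure G ≤ ρ * Φ I) (t : ℕ) :
    pushMeasure G {ω | v ∉ pushInformed s ω t} ≤ ENNReal.ofReal (ρ ^ t * Φ {s}) := by
  have hmeas : MeasurableSet {ω : ℕ → V → V | v ∉ pushInformed s ω t} :=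
    (DependsOn.measurable (Y := fun ω : ℕ → V → V => (v ∉ pushInformed s ω t : Prop)) (t := t)
      fun ω ω' h => by simp only [pushInformed_dependsOn s t h]).setOf
  rw [ENNReal.ofReal_mul (by positivity), ENNReal.ofReal_pow hρ,
    ← lintegral_indicator_one hmeas]
  refine le_trans (lintegral_mono fun ω => ?_)
    (lintegral_potential_pushInformed_le G (Φ := fun I => ENNReal.ofReal (Φ I)) (s := s)
      (fun I hI => ?_) t)
  · refine Set.indicator_apply_le' (fun h => ?_) (fun _ => bot_le)
    rw [Pi.one_apply, ENNReal.one_le_ofReal]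
    exact hone _ (mem_pushInformed_self s ω t) h
  · rw [← ofReal_integral_eq_lintegral_ofReal Integrable.of_finite
      (Filter.Eventually.of_forall fun _ => hΦ _), ← ENNReal.ofReal_mul hρ]
    exact ENNReal.ofReal_le_ofReal (hstep I hI)

theorem inv_le_randomNeighbor_toReal {d : ℕ} {u w : V} (h : G.Adj u w) (hd : G.degree u ≤ d) :
    (d : ℝ)⁻¹ ≤ (randomNeighbor G u w).toReal := by
  have h0 : 0 < G.degree u := (G.degree_pos_iff_exists_adj u).mpr ⟨w, h⟩
  rw [randomNeighbor_apply_of_adj G h, ENNReal.toReal_inv, ENNReal.toReal_natCast]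
  have : (0 : ℝ) < G.degree u := by exact_mod_cast h0
  gcongr

theorem inv_le_roundMeasure_real {d : ℕ} {u w : V} (h : G.Adj u w) (hd : G.degree u ≤ d) :
    (d : ℝ)⁻¹ ≤ (roundMeasure G).real {ξ | ξ u = w} := by
  have hmp := measurePreserving_eval (fun v : V => (randomNeighbor G v).toMeasure) u
  have h1 : (roundMeasure G) {ξ | ξ u = w} = randomNeighbor G u w := by
    rw [← PMF.toMeasure_apply_singleton _ _ (measurableSet_singleton w),
      ← hmp.measure_preimage (MeasurableSet.of_discrete).nullMeasurableSet]
    rfl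
  rw [measureReal_def, h1]
  exact inv_le_randomNeighbor_toReal G h hd

/-- The probability that none of the vertices `u ∈ K` samples its neighbor `f u`. -/
theorem roundMeasure_real_forall_ne_le {d : ℕ} (hd : 0 < d) {K : Finset V} {f : V → V}
    (hf : ∀ u ∈ K, G.Adj u (f u)) (hdeg : ∀ u ∈ K, G.degree u ≤ d) :
    (roundMeasure G).real {ξ | ∀ u ∈ K, ξ u ≠ f u} ≤ d / (d + K.card) := by
  have hset : {ξ : V → V | ∀ u ∈ K, ξ u ≠ f u} =
      Set.pi Set.univ fun u => if u ∈ K then {f u}ᶜ else Set.univ := by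
    ext ξ
    simp only [Set.mem_pi, Set.mem_univ, forall_const]
    refine forall_congr' fun u => ?_
    by_cases hu : u ∈ K <;> simp [hu]
  have hd' : (0 : ℝ) < d := by exact_mod_cast hd
  have hd1 : (d : ℝ)⁻¹ ≤ 1 := inv_le_one_of_one_le₀ (by exact_mod_cast hd)
  rw [measureReal_def, hset, Measure.pi_pi, ENNReal.toReal_prod]
  calc ∏ u, ((randomNeighbor G u).toMeasure (if u ∈ K then {f u}ᶜ else Set.univ)).toReal
      ≤ ∏ u, (if u ∈ K then 1 - (d : ℝ)⁻¹ else 1) := by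
        refine Finset.prod_le_prod (fun _ _ => ENNReal.toReal_nonneg) fun u _ => ?_
        by_cases hu : u ∈ K
        · rw [if_pos hu, if_pos hu, ← measureReal_def,
            probReal_compl_eq_one_sub (measurableSet_singleton _), measureReal_def,
            PMF.toMeasure_apply_singleton _ _ (measurableSet_singleton _)]
          have := inv_le_randomNeighbor_toReal G (hf u hu) (hdeg u hu)
          linarith
        · simp [hu]
    _ = (1 - (d : ℝ)⁻¹) ^ K.card := by
        rw [Finset.prod_ite_mem, Finset.univ_inter, Finset.prod_const]
    _ ≤ d / (d + K.card) := by
        -- From `(1 - 1/d) (1 + 1/d) ≤ 1` and Bernoulli's inequality, `(1 - 1/d) ^ k ≤ 1 / (1 +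
        -- k/d)`.
        rw [le_div_iff₀ (by positivity)]
        have h1 : 1 + (K.card : ℝ) * (d : ℝ)⁻¹ ≤ (1 + (d : ℝ)⁻¹) ^ K.card :=
          one_add_mul_le_pow (by have : 0 ≤ (d : ℝ)⁻¹ := by positivity
                                 linarith) _
        have h2 : (1 - (d : ℝ)⁻¹) ^ K.card * (1 + (d : ℝ)⁻¹) ^ K.card ≤ 1 := by
          rw [← mul_pow]
          refine pow_le_one₀ (by nlinarith [inv_pos.mpr hd']) ?_
          nlinarith [sq_nonneg (d : ℝ)⁻¹]
        have h3 : 0 ≤ (1 - (d : ℝ)⁻¹) ^ K.card := pow_nonneg (by linarith) _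
        have h4 : (d : ℝ) + K.card = d * (1 + (K.card : ℝ) * (d : ℝ)⁻¹) := by field_simp
        rw [h4]
        nlinarith [mul_le_mul_of_nonneg_left h1 h3]

/-- In a clique of vertices of small degree, the reciprocal of the number of informed vertices
contracts in expectation as long as at most half of the vertices are informed. -/
theorem integral_inv_card_le {C : Finset V} (hC : ∀ u ∈ C, ∀ w ∈ C, u ≠ w → G.Adj u w)
    (hdeg : ∀ u ∈ C, G.degree u ≤ C.card) {I : Set V} [DecidablePred (· ∈ I)]
    (h0 : 0 < (C.filter (· ∈ I)).card) (hhalf : 2 * (C.filter (· ∈ I)).card ≤ C.card) :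
    ∫ ξ, (((C : Set V) ∩ pushStep I ξ).ncard : ℝ)⁻¹ ∂roundMeasure G ≤
      5 / 6 * ((C.filter (· ∈ I)).card : ℝ)⁻¹ := by
  classical
  set K := C.filter (· ∈ I) with hK
  set k := K.card with hk
  set L := C.card with hL
  have hk0 : (0 : ℝ) < k := by exact_mod_cast h0
  have hkL : 2 * (k : ℝ) ≤ L := by exact_mod_cast hhalf
  let hit : V → Set (V → V) := fun w => {ξ | ∃ u ∈ K, ξ u = w}
  let N : (V → V) → ℝ := fun ξ => ∑ w ∈ C \ K, (hit w).indicator 1 ξ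
  have hN : ∀ ξ, N ξ = ((C \ K).filter fun w => ∃ u ∈ K, ξ u = w).card := by
    intro ξ
    simp only [N, hit, Set.indicator_apply, Pi.one_apply]
    rw [← Finset.sum_filter, Finset.sum_const, nsmul_eq_mul, mul_one]
    rfl
  -- By convexity `1 / (k + x)` lies below its chord on `[0, k]`. The number of new vertices of `C`
  -- sampled from `K` is in this range because each vertex of `K` samples only once. The bound is
  -- linear, so only the mean is needed.
  have hpoint : ∀ ξ, (((C : Set V) ∩ pushStep I ξ).ncard : ℝ)⁻¹ ≤
      (k : ℝ)⁻¹ - (2 * (k : ℝ) ^ 2)⁻¹ * N ξ := by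
    intro ξ
    set F := (C \ K).filter fun w => ∃ u ∈ K, ξ u = w with hF
    have hsub : ((K ∪ F : Finset V) : Set V) ⊆ (C : Set V) ∩ pushStep I ξ := by
      intro w hw
      rw [Finset.mem_coe, Finset.mem_union] at hw
      rcases hw with hw | hw
      · rw [hK, Finset.mem_filter] at hw
        exact ⟨hw.1, Or.inl hw.2⟩
      · rw [hF, Finset.mem_filter, Finset.mem_sdiff] at hw
        obtain ⟨⟨hwC, -⟩, u, hu, huw⟩ := hw
        exact ⟨hwC, Or.inr ⟨u, (Finset.mem_filter.mp hu).2, huw⟩⟩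
    have hdisj : Disjoint K F :=
      Finset.disjoint_left.mpr fun w hw hwF =>
        (Finset.mem_sdiff.mp (Finset.mem_filter.mp hwF).1).2 hw
    have hcard : k + F.card ≤ ((C : Set V) ∩ pushStep I ξ).ncard := by
      rw [hk, ← Finset.card_union_of_disjoint hdisj, ← Set.ncard_coe_finset]
      exact Set.ncard_le_ncard hsub
    have hFk : F.card ≤ k := by
      refine (Finset.card_le_card (t := K.image ξ) fun w hw => ?_).trans Finset.card_image_le
      obtain ⟨u, hu, huw⟩ := (Finset.mem_filter.mp hw).2
      exact Finset.mem_image.mpr ⟨u, hu, huw⟩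
    rw [hN]
    have hcard' : (k : ℝ) + F.card ≤ ((C : Set V) ∩ pushStep I ξ).ncard := by
      exact_mod_cast hcard
    have hFk' : (F.card : ℝ) ≤ k := by exact_mod_cast hFk
    have hF0 : (0 : ℝ) ≤ F.card := by positivity
    refine (inv_anti₀ (by positivity) hcard').trans ?_
    have hrw : (k : ℝ)⁻¹ - (2 * (k : ℝ) ^ 2)⁻¹ * F.card = (2 * k - F.card) / (2 * (k : ℝ) ^ 2) := by
      field_simp
    rw [hrw, inv_eq_one_div, div_le_div_iff₀ (by positivity) (by positivity)]
    nlinarith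
  -- Each of the `L - k` uninformed vertices is hit with probability at least `k / (L + k)`, and `(L
  -- - k) / (L + k) ≥ 1/3` when `2 k ≤ L`.
  have hmean : (k : ℝ) / 3 ≤ ∫ ξ, N ξ ∂roundMeasure G := by
    have hint : ∫ ξ, N ξ ∂roundMeasure G = ∑ w ∈ C \ K, (roundMeasure G).real (hit w) := by
      rw [integral_finsetSum _ fun _ _ => Integrable.of_finite]
      exact Finset.sum_congr rfl fun w _ => integral_indicator_one MeasurableSet.of_discrete
    have hw : ∀ w ∈ C \ K, (k : ℝ) / (L + k) ≤ (roundMeasure G).real (hit w) := by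
      intro w hw
      rw [Finset.mem_sdiff] at hw
      have hmiss := roundMeasure_real_forall_ne_le G (d := L) (by omega) (K := K) (f := fun _ => w)
        (fun u hu => hC u (Finset.mem_filter.mp hu).1 w hw.1 (by rintro rfl; exact hw.2 hu))
        (fun u hu => hdeg u (Finset.mem_filter.mp hu).1)
      have hcompl : {ξ : V → V | ∀ u ∈ K, ξ u ≠ w} = (hit w)ᶜ := by
        ext ξ; simp [hit]
      rw [hcompl, probReal_compl_eq_one_sub MeasurableSet.of_discrete] at hmiss
      have : (k : ℝ) / (L + k) = 1 - L / (L + k) := by field_simp; ring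
      rw [this]; linarith
    rw [hint]
    refine le_trans ?_ (Finset.card_nsmul_le_sum _ _ _ hw)
    rw [nsmul_eq_mul, Finset.card_sdiff_of_subset (Finset.filter_subset _ _),
      Nat.cast_sub (Finset.card_filter_le _ _), ← mul_div_assoc, div_le_div_iff₀ (by norm_num) (by positivity)]
    nlinarith
  calc ∫ ξ, (((C : Set V) ∩ pushStep I ξ).ncard : ℝ)⁻¹ ∂roundMeasure G
      ≤ ∫ ξ, ((k : ℝ)⁻¹ - (2 * (k : ℝ) ^ 2)⁻¹ * N ξ) ∂roundMeasure G :=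
        integral_mono Integrable.of_finite Integrable.of_finite hpoint
    _ = (k : ℝ)⁻¹ - (2 * (k : ℝ) ^ 2)⁻¹ * ∫ ξ, N ξ ∂roundMeasure G := by
        rw [integral_sub Integrable.of_finite Integrable.of_finite, integral_const_mul]
        simp
    _ ≤ (k : ℝ)⁻¹ - (2 * (k : ℝ) ^ 2)⁻¹ * (k / 3) := by gcongr
    _ = 5 / 6 * (k : ℝ)⁻¹ := by field_simp; norm_num

end Push

/-! ### The potential of push for a fixed target -/

section Potential

variable {V : Type} [Fintype V] [DecidableEq V] [Nonempty V] [MeasurableSpace V]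
  [DiscreteMeasurableSpace V] (G : SimpleGraph V) [DecidableRel G.Adj]

/-- The vertices from which `v` can be reached by at most `k` steps out of vertices of `J`. -/
def layer (J : Set V) (v : V) : ℕ → Set V
  | 0 => {v}
  | k + 1 => layer J v k ∪ {u | u ∈ J ∧ ∃ w ∈ layer J v k, G.Adj u w}

variable {G}

theorem mem_layer_self (J : Set V) (v : V) (k : ℕ) : v ∈ layer G J v k := by
  induction k with
  | zero => exact Set.mem_singleton v
  | succ k ih => exact Or.inl ih

theorem layer_mono {J : Set V} {v : V} : Monotone (layer G J v) :=
  monotone_nat_of_le_succ fun _ _ h => Or.inl h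

theorem mem_layer_add {J : Set V} {u v w : V} {k l : ℕ} (hw : w ∈ layer G J v k)
    (hu : u ∈ layer G J w l) : u ∈ layer G J v (k + l) := by
  induction l generalizing u with
  | zero => obtain rfl := hu; exact hw
  | succ l ih =>
    rcases hu with hu | ⟨huJ, x, hx, hux⟩
    · exact Or.inl (ih hu)
    · exact Or.inr ⟨huJ, x, ih hx, hux⟩

variable (G)

/-- The first layer that meets `I`. -/
noncomputable def layerDist (J : Set V) (v : V) (I : Set V) : ℕ :=
  sInf {k | (I ∩ layer G J v k).Nonempty}

open Classical in
/-- The potential of push for the target `v`: it is exponential in the distance to `v` once a vertex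
near `v` is informed, and before it is inversely proportional to the number of informed vertices
of `C`. -/
noncomputable def potential (C : Finset V) (J : Set V) (v : V) (D : ℕ) (I : Set V) : ℝ :=
  if v ∈ I then 0
  else if (I ∩ layer G J v D).Nonempty then 2 ^ layerDist G J v I
  else 4 * C.card * 2 ^ D * (((C : Set V) ∩ I).ncard : ℝ)⁻¹

variable {G}

theorem potential_nonneg (C : Finset V) (J : Set V) (v : V) (D : ℕ) (I : Set V) :
    0 ≤ potential G C J v D I := by
  unfold potential
  split_ifs <;> positivity

theorem potential_of_mem {C : Finset V} {J : Set V} {v : V} {D : ℕ} {I : Set V} (h : v ∈ I) :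
    potential G C J v D I = 0 :=
  if_pos h

theorem potential_le_of_meets {C : Finset V} {J : Set V} {v : V} {D k : ℕ} {I : Set V}
    (hk : k ≤ D) (h : (I ∩ layer G J v k).Nonempty) : potential G C J v D I ≤ 2 ^ k := by
  have hD : (I ∩ layer G J v D).Nonempty :=
    h.mono (Set.inter_subset_inter_right _ (layer_mono hk))
  unfold potential
  rw [if_pos hD]
  split_ifs
  · positivity
  · exact pow_le_pow_right₀ (by norm_num) (Nat.sInf_le h)

/-- The clique expression is at least `4 * 2 ^ D` because at most `C.card` vertices of `C` are
informed. It thus dominates every branch, and a phase change can only lower the potential. -/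
theorem potential_le_inv {C : Finset V} {J : Set V} {v : V} {D : ℕ} {I : Set V}
    (h : ((C : Set V) ∩ I).Nonempty) :
    potential G C J v D I ≤ 4 * C.card * 2 ^ D * (((C : Set V) ∩ I).ncard : ℝ)⁻¹ := by
  by_cases hD : (I ∩ layer G J v D).Nonempty
  · refine (potential_le_of_meets le_rfl hD).trans ?_
    have h1 : 0 < ((C : Set V) ∩ I).ncard := (Set.ncard_pos).mpr h
    have h2 : ((C : Set V) ∩ I).ncard ≤ C.card := by
      rw [← Set.ncard_coe_finset C]
      exact Set.ncard_le_ncard Set.inter_subset_left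
    have h1' : (0 : ℝ) < ((C : Set V) ∩ I).ncard := by exact_mod_cast h1
    have h2' : (((C : Set V) ∩ I).ncard : ℝ) ≤ C.card := by exact_mod_cast h2
    have h3 : (0 : ℝ) < 2 ^ D := by positivity
    rw [← div_eq_mul_inv, le_div_iff₀ h1']
    nlinarith
  · unfold potential
    rw [if_neg hD]
    split_ifs
    · positivity
    · exact le_rfl

variable (G) in
-- The rate `7/8` is that of the path phase; growth in the clique contracts at rate `5/6` and the
-- exit from the clique at rate `3/4`.
theorem integral_potential_pushStep_le {C : Finset V} {J : Set V} {D : ℕ} {s v : V}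
    (hC : ∀ u ∈ C, ∀ w ∈ C, u ≠ w → G.Adj u w) (hCdeg : ∀ u ∈ C, G.degree u ≤ C.card)
    (hCJ : ∀ u ∈ C, ∃ w ∈ J, G.Adj u w) (hJdeg : ∀ u ∈ J, G.degree u ≤ 4)
    (hJ : J ⊆ layer G J v D) (hs : s ∈ J ∨ s ∈ C) {I : Set V} (hI : s ∈ I) :
    ∫ ξ, potential G C J v D (pushStep I ξ) ∂roundMeasure G ≤
      7 / 8 * potential G C J v D I := by
  classical
  have hsub : ∀ ξ, I ⊆ pushStep I ξ := fun ξ => Set.subset_union_left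
  by_cases hv : v ∈ I
  · have : ∀ ξ, potential G C J v D (pushStep I ξ) = 0 := fun ξ => potential_of_mem (hsub ξ hv)
    simp [this, potential_of_mem hv]
  by_cases hD : (I ∩ layer G J v D).Nonempty
  · -- a sample of the informed vertex nearest to `v` halves the potential
    have hΦ : potential G C J v D I = 2 ^ layerDist G J v I := by
      rw [potential, if_neg hv, if_pos hD]
    obtain ⟨u, huI, hu⟩ : (I ∩ layer G J v (layerDist G J v I)).Nonempty :=
      Nat.sInf_mem (s := {k | (I ∩ layer G J v k).Nonempty}) ⟨D, hD⟩
    have hkD : layerDist G J v I ≤ D := Nat.sInf_le hD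
    have hmin : ∀ k < layerDist G J v I, ¬ (I ∩ layer G J v k).Nonempty :=
      fun k hk => Nat.notMem_of_lt_sInf hk
    rw [hΦ]
    generalize layerDist G J v I = k at *
    cases k with
    | zero => obtain rfl := hu; exact (hv huI).elim
    | succ j =>
      rcases hu with hu | ⟨huJ, w, hw, huw⟩
      · exact (hmin j (Nat.lt_succ_self j) ⟨u, huI, hu⟩).elim
      -- The good sample has probability at least `1/4`, so the mean is at most `2 ^ (j + 1) - 2 ^ j
      -- / 4`, that is, `7/8` of `2 ^ (j + 1)`.
      have hpoint : ∀ ξ, potential G C J v D (pushStep I ξ) ≤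
          2 ^ (j + 1) - 2 ^ j * {ξ : V → V | ξ u = w}.indicator 1 ξ := by
        intro ξ
        by_cases hξ : ξ u = w
        · have h1 := potential_le_of_meets (C := C) (D := D) (k := j) (by omega)
            (⟨w, Or.inr ⟨u, huI, hξ⟩, hw⟩ : (pushStep I ξ ∩ layer G J v j).Nonempty)
          rw [Set.indicator_of_mem (by exact hξ), Pi.one_apply]
          refine h1.trans (le_of_eq ?_)
          ring
        · have h1 := potential_le_of_meets (C := C) (D := D) (k := j + 1) hkD
            (⟨u, hsub ξ huI, Or.inr ⟨huJ, w, hw, huw⟩⟩ :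
              (pushStep I ξ ∩ layer G J v (j + 1)).Nonempty)
          rw [Set.indicator_of_notMem (by exact hξ), mul_zero, sub_zero]
          exact h1
      refine (integral_mono Integrable.of_finite Integrable.of_finite hpoint).trans ?_
      rw [integral_sub Integrable.of_finite Integrable.of_finite, integral_const_mul,
        integral_indicator_one MeasurableSet.of_discrete]
      have hp := inv_le_roundMeasure_real G huw (hJdeg u huJ)
      simp only [integral_const, probReal_univ, one_smul]
      have h2 : (0 : ℝ) < 2 ^ j := by positivity
      rw [pow_succ]
      push_cast at hp
      nlinarith
  · -- no vertex of `J` is informed yet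
    have hsC : s ∈ C := hs.resolve_left fun h => hD ⟨s, hI, hJ h⟩
    have hΦ : potential G C J v D I = 4 * C.card * 2 ^ D * (((C : Set V) ∩ I).ncard : ℝ)⁻¹ := by
      rw [potential, if_neg hv, if_neg hD]
    have hcard : ((C : Set V) ∩ I).ncard = (C.filter (· ∈ I)).card := by
      rw [← Set.ncard_coe_finset, Finset.coe_filter]; rfl
    have h0 : 0 < (C.filter (· ∈ I)).card :=
      Finset.card_pos.mpr ⟨s, Finset.mem_filter.mpr ⟨hsC, hI⟩⟩
    have hkC : (C.filter (· ∈ I)).card ≤ C.card := Finset.card_filter_le _ _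
    rw [hΦ, hcard]
    have hle : ∀ ξ, potential G C J v D (pushStep I ξ) ≤
        4 * C.card * 2 ^ D * (((C : Set V) ∩ pushStep I ξ).ncard : ℝ)⁻¹ :=
      fun ξ => potential_le_inv ⟨s, hsC, hsub ξ hI⟩
    have hk0 : (0 : ℝ) < (C.filter (· ∈ I)).card := by exact_mod_cast h0
    have hD0 : (0 : ℝ) < 2 ^ D := by positivity
    by_cases hhalf : 2 * (C.filter (· ∈ I)).card ≤ C.card
    · calc ∫ ξ, potential G C J v D (pushStep I ξ) ∂roundMeasure G
          ≤ ∫ ξ, 4 * C.card * 2 ^ D * (((C : Set V) ∩ pushStep I ξ).ncard : ℝ)⁻¹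
              ∂roundMeasure G :=
            integral_mono Integrable.of_finite Integrable.of_finite hle
        _ = 4 * C.card * 2 ^ D * ∫ ξ, (((C : Set V) ∩ pushStep I ξ).ncard : ℝ)⁻¹
              ∂roundMeasure G := integral_const_mul _ _
        _ ≤ 4 * C.card * 2 ^ D * (5 / 6 * ((C.filter (· ∈ I)).card : ℝ)⁻¹) := by
            gcongr
            exact integral_inv_card_le G hC hCdeg h0 hhalf
        _ ≤ 7 / 8 * (4 * C.card * 2 ^ D * ((C.filter (· ∈ I)).card : ℝ)⁻¹) := by
            have : (0 : ℝ) ≤ 4 * C.card * 2 ^ D * ((C.filter (· ∈ I)).card : ℝ)⁻¹ := by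
              positivity
            linarith
    -- More than half of `C` is informed: now the gain comes from some informed vertex of `C`
    -- sampling its chosen neighbor in `J`, which brings the potential down to at most `2 ^ D`.
    · choose! f hfJ hf using hCJ
      set M : ℝ := 4 * C.card * 2 ^ D * ((C.filter (· ∈ I)).card : ℝ)⁻¹ with hM
      have hDM : 2 ^ D ≤ M / 4 := by
        have hkC' : ((C.filter (· ∈ I)).card : ℝ) ≤ C.card := by exact_mod_cast hkC
        have hMk : M * (C.filter (· ∈ I)).card = 4 * C.card * 2 ^ D := by
          rw [hM]; field_simp
        by_contra hcon
        push Not at hcon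
        nlinarith
      let A : Set (V → V) := {ξ | ∀ u ∈ C.filter (· ∈ I), ξ u ≠ f u}
      have hq : (roundMeasure G).real A ≤ 2 / 3 := by
        refine (roundMeasure_real_forall_ne_le G (d := C.card) (by omega)
          (fun u hu => hf u (Finset.mem_filter.mp hu).1)
          (fun u hu => hCdeg u (Finset.mem_filter.mp hu).1)).trans ?_
        rw [div_le_div_iff₀ (by positivity) (by norm_num)]
        have : (C.card : ℝ) ≤ 2 * (C.filter (· ∈ I)).card := by
          exact_mod_cast (not_le.mp hhalf).le
        linarith
      have hpoint : ∀ ξ, potential G C J v D (pushStep I ξ) ≤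
          2 ^ D + (M - 2 ^ D) * A.indicator 1 ξ := by
        intro ξ
        by_cases hξ : ξ ∈ A
        · rw [Set.indicator_of_mem hξ, Pi.one_apply, mul_one, add_sub_cancel]
          refine (hle ξ).trans ?_
          rw [hM, ← hcard]
          have : ((C : Set V) ∩ I).ncard ≤ ((C : Set V) ∩ pushStep I ξ).ncard :=
            Set.ncard_le_ncard (Set.inter_subset_inter_right _ (hsub ξ))
          rw [← hcard] at hk0
          gcongr
        · rw [Set.indicator_of_notMem hξ, mul_zero, add_zero]
          have : ∃ u ∈ C.filter (· ∈ I), ξ u = f u := by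
            by_contra hcon
            push Not at hcon
            exact hξ hcon
          obtain ⟨u, hu, huf⟩ := this
          rw [Finset.mem_filter] at hu
          exact potential_le_of_meets le_rfl
            ⟨f u, Or.inr ⟨u, hu.2, huf⟩, hJ (hfJ u hu.1)⟩
      refine (integral_mono Integrable.of_finite Integrable.of_finite hpoint).trans ?_
      rw [integral_add Integrable.of_finite Integrable.of_finite, integral_const_mul,
        integral_indicator_one MeasurableSet.of_discrete]
      simp only [integral_const, probReal_univ, one_smul]
      -- The mean is at most `2 ^ D / 3 + 2 M / 3`, hence at most `3 M / 4` by `hDM`; this is what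
      -- the factor 4 in the potential is for.
      nlinarith

variable (G) in
theorem pushMeasure_notMem_le_of_clique {C : Finset V} {J : Set V} {D : ℕ} {s v : V}
    (hC0 : C.Nonempty)
    (hC : ∀ u ∈ C, ∀ w ∈ C, u ≠ w → G.Adj u w) (hCdeg : ∀ u ∈ C, G.degree u ≤ C.card)
    (hCJ : ∀ u ∈ C, ∃ w ∈ J, G.Adj u w) (hJdeg : ∀ u ∈ J, G.degree u ≤ 4)
    (hJ : J ⊆ layer G J v D) (hs : s ∈ J ∨ s ∈ C) (t : ℕ) :
    pushMeasure G {ω | v ∉ pushInformed s ω t} ≤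
      ENNReal.ofReal ((7 / 8) ^ t * (4 * C.card * 2 ^ D)) := by
  have hC1 : (1 : ℝ) ≤ C.card := by exact_mod_cast hC0.card_pos
  have hD1 : (1 : ℝ) ≤ 2 ^ D := one_le_pow₀ (by norm_num)
  refine (pushMeasure_notMem_le G (Φ := potential G C J v D) (ρ := 7 / 8) (s := s) (v := v)
    (by norm_num) (potential_nonneg C J v D) (fun I hI hv => ?_) (fun I hI =>
      integral_potential_pushStep_le G hC hCdeg hCJ hJdeg hJ hs hI) t).trans
    (ENNReal.ofReal_le_ofReal ?_)
  · by_cases hD : (I ∩ layer G J v D).Nonempty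
    · rw [potential, if_neg hv, if_pos hD]
      exact one_le_pow₀ (by norm_num)
    · have hsC : s ∈ C := hs.resolve_left fun h => hD ⟨s, hI, hJ h⟩
      rw [potential, if_neg hv, if_neg hD]
      have h1 : 0 < ((C : Set V) ∩ I).ncard := (Set.ncard_pos).mpr ⟨s, hsC, hI⟩
      have h2 : ((C : Set V) ∩ I).ncard ≤ C.card := by
        rw [← Set.ncard_coe_finset C]
        exact Set.ncard_le_ncard Set.inter_subset_left
      have h1' : (0 : ℝ) < ((C : Set V) ∩ I).ncard := by exact_mod_cast h1
      have h2' : (((C : Set V) ∩ I).ncard : ℝ) ≤ C.card := by exact_mod_cast h2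
      rw [← div_eq_mul_inv, le_div_iff₀ h1']
      nlinarith
  · gcongr
    rcases hs with hs | hs
    · refine (potential_le_of_meets le_rfl ⟨s, Set.mem_singleton s, hJ hs⟩).trans ?_
      nlinarith
    · refine (potential_le_inv ⟨s, hs, Set.mem_singleton s⟩).trans ?_
      have : (C : Set V) ∩ {s} = {s} := by simpa using hs
      rw [this, Set.ncard_singleton]
      simp

end Potential

/-! ### Push on the Siamese heavy binary tree -/

section SiamesePush

variable {n : ℕ} [NeZero n]

/-- The vertices of the Siamese heavy binary tree that are not leaves. -/
def internalVertices (n : ℕ) [NeZero n] : Set (SiameseVertex n) :=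
  {x | ∃ b i, ¬ IsLeaf i ∧ Siamese.inCopy (0 : Fin n) b i = x}

/-- Numbered from 1, the parent is the integer half, so the binary logarithm is the depth in the
tree. -/
theorem log_treeParent_add_one {i : Fin n} (hi : i ≠ 0) :
    Nat.log 2 ((treeParent i : ℕ) + 1) + 1 = Nat.log 2 ((i : ℕ) + 1) := by
  have h0 : (i : ℕ) ≠ 0 := fun h => hi (Fin.ext (by simpa using h))
  have h1 : (treeParent i : ℕ) + 1 = ((i : ℕ) + 1) / 2 := by
    simp only [treeParent]; omega
  rw [h1, Nat.log_div_base]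
  have := Nat.log_pos (b := 2) (n := (i : ℕ) + 1) (by norm_num) (by omega)
  omega

theorem treeParent_lt {i : Fin n} (hi : i ≠ 0) : (treeParent i : ℕ) < i := by
  have h0 : (i : ℕ) ≠ 0 := fun h => hi (Fin.ext (by simpa using h))
  simp only [treeParent]; omega

/-- The path descends from the root, and each of its steps leaves a parent, hence an internal
vertex; the endpoint itself may be a leaf. -/
theorem root_mem_layer (b : Bool) (k : ℕ) (i : Fin n) (hk : (i : ℕ) = k) :
    siameseRoot n ∈ layer (siameseHeavyBinaryTree n) (internalVertices n) (Siamese.inCopy 0 b i)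
      (Nat.log 2 ((i : ℕ) + 1)) := by
  induction k using Nat.strong_induction_on generalizing i with
  | _ k ih =>
    by_cases hi : i = 0
    · rw [hi, Siamese.inCopy_zero]
      exact mem_layer_self _ _ _
    · have h1 := ih _ (hk ▸ treeParent_lt hi) (treeParent i) rfl
      have h2 : Siamese.inCopy 0 b (treeParent i) ∈ layer (siameseHeavyBinaryTree n)
          (internalVertices n) (Siamese.inCopy 0 b i) 1 :=
        Or.inr ⟨⟨b, _, not_isLeaf_treeParent hi, rfl⟩, _, rfl,
          siamese_adj_inCopy (adj_treeParent hi).symm⟩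
      rw [← log_treeParent_add_one hi, add_comm]
      exact mem_layer_add h2 h1

theorem internal_mem_layer_root (b : Bool) (k : ℕ) (i : Fin n) (hk : (i : ℕ) = k)
    (hl : ¬ IsLeaf i) :
    Siamese.inCopy 0 b i ∈ layer (siameseHeavyBinaryTree n) (internalVertices n) (siameseRoot n)
      (Nat.log 2 ((i : ℕ) + 1)) := by
  induction k using Nat.strong_induction_on generalizing i with
  | _ k ih =>
    by_cases hi : i = 0
    · rw [hi, Siamese.inCopy_zero]
      exact mem_layer_self _ _ _
    · have h1 := ih _ (hk ▸ treeParent_lt hi) (treeParent i) rfl (not_isLeaf_treeParent hi)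
      rw [← log_treeParent_add_one hi]
      exact Or.inr ⟨⟨b, i, hl, rfl⟩, _, h1, siamese_adj_inCopy (adj_treeParent hi)⟩

theorem internalVertices_subset_layer (v : SiameseVertex n) :
    internalVertices n ⊆
      layer (siameseHeavyBinaryTree n) (internalVertices n) v (Nat.log 2 n + Nat.log 2 n) := by
  rintro _ ⟨b, i, hi, rfl⟩
  obtain ⟨c, j, rfl⟩ := Siamese.exists_inCopy v
  refine layer_mono ?_
    (mem_layer_add (root_mem_layer c _ j rfl) (internal_mem_layer_root b _ i rfl hi))
  exact add_le_add (Nat.log_mono_right (by omega)) (Nat.log_mono_right (by omega))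

/-- The clique is taken in the copy of `s`, but the internal vertices in both copies, so `v` may lie
on either side. The power `n ^ 3` is one factor for the size of the clique and two for `2 ^ D`. -/
theorem pushMeasure_siamese_notMem_le (hn : 2 ≤ n) (s v : SiameseVertex n) (t : ℕ) :
    pushMeasure (siameseHeavyBinaryTree n) {ω | v ∉ pushInformed s ω t} ≤
      ENNReal.ofReal ((7 / 8) ^ t * (4 * (n : ℝ) ^ 3)) := by
  obtain ⟨b, i, rfl⟩ := Siamese.exists_inCopy s
  have hmem : ∀ x ∈ leafClique n b, ∃ i, IsLeaf i ∧ Siamese.inCopy 0 b i = x := by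
    intro x hx
    obtain ⟨i, hi, rfl⟩ := Finset.mem_image.mp hx
    exact ⟨i, by simpa [leaves] using hi, rfl⟩
  have hpos : 0 < (leafClique n b).card := by
    rw [card_leafClique]
    have := le_two_mul_card_leaves (n := n)
    omega
  refine (pushMeasure_notMem_le_of_clique _ (C := leafClique n b) (J := internalVertices n)
    (D := Nat.log 2 n + Nat.log 2 n) (Finset.card_pos.mp hpos) ?_ ?_ ?_ ?_
    (internalVertices_subset_layer v) ?_ t).trans (ENNReal.ofReal_le_ofReal ?_)
  · intro u hu w hw huw
    obtain ⟨i, hi, rfl⟩ := hmem u hu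
    obtain ⟨j, hj, rfl⟩ := hmem w hw
    exact siamese_adj_inCopy ⟨fun h => huw (by rw [h]), Or.inr (Or.inr ⟨hi, hj⟩)⟩
  · intro u hu
    obtain ⟨i, hi, rfl⟩ := hmem u hu
    rw [card_leafClique, siamese_degree_inCopy (hi.ne_zero hn)]
    exact card_neighborFinset_of_isLeaf hi
  · intro u hu
    obtain ⟨i, hi, rfl⟩ := hmem u hu
    exact ⟨_, ⟨b, _, not_isLeaf_treeParent (hi.ne_zero hn), rfl⟩,
      siamese_adj_inCopy (adj_treeParent (hi.ne_zero hn))⟩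
  · rintro _ ⟨c, i, hi, rfl⟩
    exact siamese_degree_le_of_not_isLeaf hn hi
  · by_cases hi : IsLeaf i
    · exact Or.inr (Finset.mem_image_of_mem _ (by simpa [leaves] using hi))
    · exact Or.inl ⟨b, i, hi, rfl⟩
  · have h1 : ((leafClique n b).card : ℝ) ≤ n := by
      rw [card_leafClique]; exact_mod_cast card_leaves_le
    have h2 : (2 : ℝ) ^ Nat.log 2 n ≤ n := by exact_mod_cast Nat.pow_log_le_self 2 (by omega)
    calc (7 / 8 : ℝ) ^ t * (4 * (leafClique n b).card * 2 ^ (Nat.log 2 n + Nat.log 2 n))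
        ≤ (7 / 8 : ℝ) ^ t * (4 * n * (n * n)) := by
          rw [pow_add]; gcongr
      _ = _ := by ring

theorem card_siameseVertex_le : Fintype.card (SiameseVertex n) ≤ 2 * n := by
  have h : Function.Surjective fun p : Bool × Fin n => Siamese.inCopy 0 p.1 p.2 := fun x => by
    obtain ⟨b, i, h⟩ := Siamese.exists_inCopy x
    exact ⟨(b, i), h⟩
  simpa using Fintype.card_le_of_surjective _ h

instance isProbabilityMeasure_pushMeasure {V : Type} [Fintype V] [MeasurableSpace V]
    [DecidableEq V] (G : SimpleGraph V) [DecidableRel G.Adj] :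
    IsProbabilityMeasure (pushMeasure G) := by
  unfold pushMeasure; infer_instance

theorem pushTime_siamese_le (hn : 2 ≤ n) (s : SiameseVertex n) (t : ℕ) :
    1 - (7 / 8) ^ t * (8 * (n : ℝ) ^ 4) ≤
      (pushMeasure (siameseHeavyBinaryTree n)).real {ω | pushTime s ω ≤ t} := by
  set P := pushMeasure (siameseHeavyBinaryTree n)
  have hcover : (Set.univ : Set (ℕ → SiameseVertex n → SiameseVertex n)) ⊆
      {ω | pushTime s ω ≤ t} ∪ ⋃ v ∈ Finset.univ, {ω | v ∉ pushInformed s ω t} := by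
    intro ω _
    by_cases h : pushInformed s ω t = Set.univ
    · exact Or.inl (firstRound_le h)
    · obtain ⟨v, hv⟩ := (Set.ne_univ_iff_exists_notMem _).mp h
      exact Or.inr (Set.mem_biUnion (Finset.mem_univ v) hv)
  have h1 : 1 ≤ P.real {ω | pushTime s ω ≤ t} +
      P.real (⋃ v ∈ Finset.univ, {ω | v ∉ pushInformed s ω t}) := by
    rw [← probReal_univ (μ := P)]
    exact (measureReal_mono hcover).trans (measureReal_union_le _ _)
  have h2 : P.real (⋃ v ∈ Finset.univ, {ω | v ∉ pushInformed s ω t}) ≤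
      (7 / 8) ^ t * (8 * (n : ℝ) ^ 4) := by
    calc P.real (⋃ v ∈ Finset.univ, {ω | v ∉ pushInformed s ω t})
        ≤ ∑ v, P.real {ω | v ∉ pushInformed s ω t} := measureReal_biUnion_finset_le _ _
      _ ≤ ∑ v : SiameseVertex n, (7 / 8) ^ t * (4 * (n : ℝ) ^ 3) := by
          refine Finset.sum_le_sum fun v _ => ?_
          exact ENNReal.toReal_le_of_le_ofReal (by positivity)
            (pushMeasure_siamese_notMem_le hn s v t)
      _ = Fintype.card (SiameseVertex n) * ((7 / 8) ^ t * (4 * (n : ℝ) ^ 3)) := by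
          rw [Finset.sum_const, nsmul_eq_mul, Finset.card_univ]
      _ ≤ (2 * n : ℕ) * ((7 / 8) ^ t * (4 * (n : ℝ) ^ 3)) := by
          gcongr
          exact card_siameseVertex_le
      _ = (7 / 8) ^ t * (8 * (n : ℝ) ^ 4) := by push_cast; ring
  linarith

theorem exists_pushTime_upper_bound (c : ℝ) (hc : 0 < c) :
    ∃ (C : ℝ) (N : ℕ), ∀ (n : ℕ) [NeZero n], N ≤ n → ∀ s : SiameseVertex n,
      1 - (n : ℝ) ^ (-c) ≤ (pushMeasure (siameseHeavyBinaryTree n)).real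
        {ω | (pushTime s ω : ℝ≥0∞) ≤ ENNReal.ofReal (C * Real.log n)} := by
  have hlog : 0 < Real.log (8 / 7) := Real.log_pos (by norm_num)
  -- Before rounding, `(7/8) ^ t` equals `n ^ (-(c + 5))`; rounding `t` down costs at most a factor
  -- `8/7`. The spare power of `n` beyond `n ^ 4` absorbs the constant `64/7`, which is below 10.
  refine ⟨(c + 5) / Real.log (8 / 7), 10, fun n _ hn s => ?_⟩
  have hn1 : (10 : ℝ) ≤ n := by exact_mod_cast hn
  have hn0 : (0 : ℝ) < n := by linarith
  have hlogn : 0 ≤ Real.log n := Real.log_nonneg (by linarith)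
  set x : ℝ := (c + 5) / Real.log (8 / 7) * Real.log n with hx
  have hx0 : 0 ≤ x := by positivity
  have hfloor := Nat.lt_floor_add_one x
  have hpow : (7 / 8 : ℝ) ^ ⌊x⌋₊ ≤ 8 / 7 * (n : ℝ) ^ (-(c + 5)) := by
    have h1 : (7 / 8 : ℝ) ^ x = (n : ℝ) ^ (-(c + 5)) := by
      rw [Real.rpow_def_of_pos (by norm_num), Real.rpow_def_of_pos hn0, hx]
      have : Real.log (7 / 8) = -Real.log (8 / 7) := by rw [← Real.log_inv]; norm_num
      rw [this]
      congr 1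
      field_simp
    rw [← h1]
    have h2 : (7 / 8 : ℝ) ^ ((⌊x⌋₊ : ℝ) + 1) ≤ (7 / 8 : ℝ) ^ x :=
      Real.rpow_le_rpow_of_exponent_ge (by norm_num) (by norm_num) hfloor.le
    rw [Real.rpow_add (by norm_num), Real.rpow_one, Real.rpow_natCast] at h2
    linarith
  have hmain : (7 / 8 : ℝ) ^ ⌊x⌋₊ * (8 * (n : ℝ) ^ 4) ≤ (n : ℝ) ^ (-c) := by
    have h3 : (n : ℝ) ^ (-c) = (n : ℝ) ^ (-(c + 5)) * (n : ℝ) ^ 5 := by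
      rw [← Real.rpow_natCast, ← Real.rpow_add hn0]
      congr 1
      push_cast; ring
    have h4 : 0 < (n : ℝ) ^ (-(c + 5)) := by positivity
    have h5 : (8 / 7 : ℝ) * (8 * (n : ℝ) ^ 4) ≤ (n : ℝ) ^ 5 := by
      rw [pow_succ]
      nlinarith [pow_pos hn0 4]
    rw [h3]
    calc (7 / 8 : ℝ) ^ ⌊x⌋₊ * (8 * (n : ℝ) ^ 4)
        ≤ (8 / 7 * (n : ℝ) ^ (-(c + 5))) * (8 * (n : ℝ) ^ 4) := by gcongr
      _ = (n : ℝ) ^ (-(c + 5)) * (8 / 7 * (8 * (n : ℝ) ^ 4)) := by ring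
      _ ≤ _ := by gcongr
  refine le_trans (by linarith) ((pushTime_siamese_le (n := n) (by omega) s ⌊x⌋₊).trans
    (measureReal_mono fun ω hω => ?_))
  have hω' : pushTime s ω ≤ (⌊x⌋₊ : ℕ∞) := hω
  calc (pushTime s ω : ℝ≥0∞) ≤ ((⌊x⌋₊ : ℕ∞) : ℝ≥0∞) := ENat.toENNReal_mono hω'
    _ = ENNReal.ofReal (⌊x⌋₊ : ℝ) := by simp
    _ ≤ ENNReal.ofReal x := ENNReal.ofReal_le_ofReal (Nat.floor_le hx0)

end SiamesePush

theorem mainTheorem9 :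
    -- `T_push = O(log n)` with probability at least `1 - n ^ (-c)`, for every constant `c`
    (∀ c : ℝ, 0 < c → ∃ (C : ℝ) (N : ℕ), ∀ (n : ℕ) [NeZero n], N ≤ n → ∀ s : SiameseVertex n,
      1 - (n : ℝ) ^ (-c) ≤ (pushMeasure (siameseHeavyBinaryTree n)).real
        {ω | (pushTime s ω : ℝ≥0∞) ≤ ENNReal.ofReal (C * Real.log n)}) ∧
    -- `E[T_visitx] = Ω(n)` and `E[T_meetx] = Ω(n)` for any number `m = Θ(n)` of agents
    (∀ a b : ℝ, 0 < a → ∃ (κ : ℝ) (N : ℕ), 0 < κ ∧ ∀ (n : ℕ) [NeZero n], N ≤ n →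
      ∀ m : ℕ, a * n ≤ m → (m : ℝ) ≤ b * n → ∀ s : SiameseVertex n,
        ENNReal.ofReal (κ * n) ≤
          ∫⁻ ω, (visitxTime s ω : ℝ≥0∞) ∂walkMeasure (siameseHeavyBinaryTree n) m) ∧
    (∀ a b : ℝ, 0 < a → ∃ (κ : ℝ) (N : ℕ), 0 < κ ∧ ∀ (n : ℕ) [NeZero n], N ≤ n →
      ∀ m : ℕ, a * n ≤ m → (m : ℝ) ≤ b * n → ∀ s : SiameseVertex n,
        ENNReal.ofReal (κ * n) ≤
          ∫⁻ ω, (meetxTime s ω : ℝ≥0∞) ∂walkMeasure (siameseHeavyBinaryTree n) m) :=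
  ⟨exists_pushTime_upper_bound, exists_visitxTime_lower_bound, exists_meetxTime_lower_bound⟩
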